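/- Let $N\ge 2$ sensors move in the plane, with positions $x_i\in\mathbb{R}^2$, $\mathbf{x}=(x_1,\dots,x_N)$, and cost functions $$f_i(\mathbf{x})=x_i^{T}r_{ii}x_i+x_i^{T}r_i+b_i+\sum_{j\in\mathcal{N}_i^p}c_{ij}\|x_i-x_j\|^2 ,$$ where $r_{ii}\in\mathbb{R}^{2\times 2}$ is symmetric positive definite and strictly diagonally dominant, $r_i\in\mathbb{R}^2$, $b_i\in\mathbb{R}$, $\mathcal{N}_i^p\subseteq\{1,\dots,N\}$ (the physical neighbours of $i$) and $c_{ij}>0$ for $j\in\mathcal{N}_i^p$. The sensors communicate over an undirected connected weighted graph with adjacency matrix $(a_{ij})$ ($a_{ij}=a_{ji}\ge 0$, $a_{ii}=0$). The dynamics are $$\dot x_i=u_i+g_i(\mathbf{x})+d_i(t),\qquad t\ge t_0,$$ where each $g_i$ is $C^2$ (so that its first and second partial derivatives are bounded on bounded sets), and each $d_i$ is $C^2$ on $[t_0,\infty)$ with $\dot d_i$ and $\ddot d_i$ bounded. The RISE-based strategy is $$u_i=-\frac{\partial f_i}{\partial x_i}(\mathbf{y}_i)-\hat z_i,\qquad \mathbf{y}_i=(y_{i1},\dots,y_{iN}),$$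 $$\dot y_{ij}=-\theta\bar\theta_{ij}\Big(\sum_{k=1}^N a_{ik}(y_{ij}-y_{kj})+a_{ij}(y_{ij}-x_j)\Big),$$ $$\dot{\hat x}_i=u_i+\hat z_i+(k_i^s+c_i)(x_i-\hat x_i),\qquad \dot{\hat z}_i=k_i^sc_i(x_i-\hat x_i)+\beta_i\,\mathrm{sgn}(x_i-\hat x_i),$$ with $y_{ij},\hat x_i,\hat z_i\in\mathbb{R}^2$, fixed constants $\bar\theta_{ij}>0$, and $\mathrm{sgn}$ taken componentwise. Solutions are understood in the sense of Filippov (absolutely continuous, satisfying the equations almost everywhere, with $\mathrm{sgn}(0)$ replaced by $[-1,1]$). Then the game has a unique Nash equilibrium $\mathbf{x}^*$. Put $\zeta_{i1}=x_i-\hat x_i$, $\zeta_{i2}=g_i(\mathbf{x})+d_i(t)-\hat z_i$, $\eta_{ij}=y_{ij}-x_j$, $\xi_i=x_i-x_i^*$, $\gamma_i=\dot\zeta_{i1}+c_i\zeta_{i1}$, and let $\mathcal{E}_f=(\zeta_1,\zeta_2,\eta,\xi,\gamma)$ be the stacked error vector with its Euclidean norm. For every $v_1>0$ there is $\theta^*(v_1)>0$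 such that for each $\theta>\theta^*$ there is $k_s^r(v_1,\theta)>0$ such that for all $k_i^s>k_s^r$ ($i=1,\dots,N$) there is $c^r(v_1,\theta,k_s)>0$ such that for all $c_i>c^r$ there is $\beta^r(v_1,\theta,k_s,c)>0$ such that for all $\beta_i>\beta^r$ the following holds. The solutions with $\|\mathcal{E}_f(t_0)\|\le v_1$, on whatever interval $[t_0,\tau]$ they are defined, satisfy $\|\mathcal{E}_f(t)\|\le B$ there with one common constant $B$ (so there is no finite escape time), and every solution on $[t_0,\infty)$ with $\|\mathcal{E}_f(t_0)\|\le v_1$ satisfies $$\|\mathcal{E}_f(t)\|\to 0\quad\text{as } t\to\infty .$$ In particular $\mathbf{x}(t)\to\mathbf{x}^*$: the sensors' positions converge asymptotically to the Nash equilibrium. -/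

import Mathlib

open Filter Topology MeasureTheory

namespace SensorSeeking

noncomputable section

/-- The plane in which every sensor moves. -/
abbrev Plane := EuclideanSpace ℝ (Fin 2)

/-- A profile `(x₁, …, x_N)` of sensor positions. -/
abbrev Profile (N : ℕ) := Fin N → Plane

/-! ### Games -/

/-- `xs` is a Nash equilibrium of the game with cost functions `f`: no player can lower its own
cost by a unilateral deviation. -/
def IsNash {N : ℕ} (f : Fin N → Profile N → ℝ) (xs : Profile N) : Prop :=
  ∀ (i : Fin N) (w : Plane), f i xs ≤ f i (Function.update xs i w)

/-- The partial gradient `∂f_i/∂x_i` of player `i`'s cost in its own action, evaluated at the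
profile `v`. -/
def ownGradient {N : ℕ} (f : Fin N → Profile N → ℝ) (i : Fin N) (v : Profile N) : Plane :=
  gradient (fun w : Plane => f i (Function.update v i w)) (v i)

/-- The data of a sensor connectivity game. -/
structure ConnectivityGame (N : ℕ) where
  /-- the matrices `r_ii` -/
  r : Fin N → Matrix (Fin 2) (Fin 2) ℝ
  /-- the vectors `r_i` -/
  q : Fin N → Plane
  /-- the constants `b_i` -/
  b : Fin N → ℝ
  /-- the physical neighbour sets -/
  nbr : Fin N → Finset (Fin N)
  /-- the weights `c_ij` -/
  w : Fin N → Fin N → ℝ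
  posDef : ∀ i, (r i).PosDef
  diagDominant : ∀ i k, ∑ l ∈ Finset.univ.erase k, |r i k l| < |r i k k|
  w_pos : ∀ i, ∀ j ∈ nbr i, 0 < w i j

/-- The cost of sensor `i`:
`x_iᵀ r_ii x_i + x_iᵀ r_i + b_i + ∑_{j physical neighbour of i} c_ij ‖x_i - x_j‖²`. -/
def ConnectivityGame.cost {N : ℕ} (G : ConnectivityGame N) (i : Fin N) (x : Profile N) : ℝ :=
  ((x i).ofLp ⬝ᵥ Matrix.mulVec (G.r i) (x i).ofLp + (x i).ofLp ⬝ᵥ (G.q i).ofLp + G.b i)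
    + ∑ j ∈ G.nbr i, G.w i j * ‖x i - x j‖ ^ 2

/-! ### Communication graph -/

/-- An undirected and connected weighted communication graph, given by its adjacency matrix. -/
structure CommGraph (N : ℕ) where
  a : Fin N → Fin N → ℝ
  nonneg : ∀ i j, 0 ≤ a i j
  diag : ∀ i, a i i = 0
  symm : ∀ i j, a i j = a j i
  connected : (SimpleGraph.fromRel fun i j => 0 < a i j).Connected

/-! ### Unmodelled terms and disturbances -/

/-- The disturbances are twice continuously differentiable on `[t₀, ∞)`, with bounded first and
second derivatives there. -/
def AdmissibleDisturbance {N : ℕ} (t₀ : ℝ) (d : Fin N → ℝ → Plane) : Prop :=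
  ∀ i, ContDiffOn ℝ 2 (d i) (Set.Ici t₀) ∧
    (∃ C, ∀ t ∈ Set.Ici t₀, ‖iteratedDerivWithin 1 (d i) (Set.Ici t₀) t‖ ≤ C) ∧
    (∃ C, ∀ t ∈ Set.Ici t₀, ‖iteratedDerivWithin 2 (d i) (Set.Ici t₀) t‖ ≤ C)

/-! ### The closed loop -/

/-- The gains of the seeking strategy: `θ_ij = θ * θbar i j`. -/
structure Gains (N : ℕ) where
  θ : ℝ
  θbar : Fin N → Fin N → ℝ
  ks : Fin N → ℝ
  c : Fin N → ℝ
  β : Fin N → ℝ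

/-- Everything that determines the closed loop: the costs `f`, the communication graph `A`, the
unmodelled terms `g`, the disturbances `d` and the gains `K`. -/
structure Loop (N : ℕ) where
  f : Fin N → Profile N → ℝ
  A : CommGraph N
  g : Fin N → Profile N → Plane
  d : Fin N → ℝ → Plane
  K : Gains N

/-- The state of the closed loop: positions `x_i`, estimates `y_ij` (by `i` of the position of
`j`), and observer states `x̂_i` and `ẑ_i`. -/
structure State (N : ℕ) where
  x : Profile N
  y : Fin N → Profile N
  xh : Profile N
  zh : Profile N

variable {N : ℕ}

/-- Control input `u_i = -∂f_i/∂x_i (y_i) - ẑ_i`. -/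
def Loop.u (P : Loop N) (s : State N) (i : Fin N) : Plane :=
  -ownGradient P.f i (s.y i) - s.zh i

/-- The extended state `z_i = g_i(x) + d_i(t)`. -/
def Loop.z (P : Loop N) (t : ℝ) (s : State N) (i : Fin N) : Plane :=
  P.g i s.x + P.d i t

/-- Right-hand side for `x_i`: `u_i + g_i(x) + d_i(t)`. -/
def Loop.xDot (P : Loop N) (t : ℝ) (s : State N) (i : Fin N) : Plane :=
  P.u s i + P.g i s.x + P.d i t

/-- Right-hand side for `y_ij`: `-θ_ij (∑_k a_ik (y_ij - y_kj) + a_ij (y_ij - x_j))`. -/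
def Loop.yDot (P : Loop N) (s : State N) (i j : Fin N) : Plane :=
  -((P.K.θ * P.K.θbar i j) •
    ((∑ k, P.A.a i k • (s.y i j - s.y k j)) + P.A.a i j • (s.y i j - s.x j)))

/-- Right-hand side for `x̂_i`: `u_i + ẑ_i + (k_i^s + c_i)(x_i - x̂_i)`. -/
def Loop.xhDot (P : Loop N) (s : State N) (i : Fin N) : Plane :=
  P.u s i + s.zh i + (P.K.ks i + P.K.c i) • (s.x i - s.xh i)

/-- The signum function made set-valued at its jump (Filippov regularization): `{sgn r}` for
`r ≠ 0`, and `[-1, 1]` for `r = 0`. -/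
def SGN (r : ℝ) : Set ℝ :=
  {v | v ∈ Set.Icc (-1 : ℝ) 1 ∧ (r ≠ 0 → v = Real.sign r)}

/-- Right-hand side for `ẑ_i`, set-valued where a component of `x_i - x̂_i` vanishes:
`k_i^s c_i (x_i - x̂_i) + β_i SGN (x_i - x̂_i)`, with `SGN` taken componentwise. -/
def Loop.zhDot (P : Loop N) (s : State N) (i : Fin N) : Set Plane :=
  {v | ∃ σ : Plane, (∀ k, σ k ∈ SGN ((s.x i - s.xh i) k)) ∧
    v = (P.K.ks i * P.K.c i) • (s.x i - s.xh i) + P.K.β i • σ}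

/-- `X` is a (Filippov) solution of the closed loop on the compact interval `[t₀, τ]`: it is
absolutely continuous there and satisfies the closed-loop equations at almost every time. -/
structure IsSolutionOn (P : Loop N) (t₀ τ : ℝ) (X : ℝ → State N) : Prop where
  ac_x : ∀ i, AbsolutelyContinuousOnInterval (fun t => (X t).x i) t₀ τ
  ac_y : ∀ i j, AbsolutelyContinuousOnInterval (fun t => (X t).y i j) t₀ τ
  ac_xh : ∀ i, AbsolutelyContinuousOnInterval (fun t => (X t).xh i) t₀ τ
  ac_zh : ∀ i, AbsolutelyContinuousOnInterval (fun t => (X t).zh i) t₀ τ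
  eq_x : ∀ i, ∀ᵐ t ∂(volume.restrict (Set.Icc t₀ τ)),
    HasDerivAt (fun t => (X t).x i) (P.xDot t (X t) i) t
  eq_y : ∀ i j, ∀ᵐ t ∂(volume.restrict (Set.Icc t₀ τ)),
    HasDerivAt (fun t => (X t).y i j) (P.yDot (X t) i j) t
  eq_xh : ∀ i, ∀ᵐ t ∂(volume.restrict (Set.Icc t₀ τ)),
    HasDerivAt (fun t => (X t).xh i) (P.xhDot (X t) i) t
  eq_zh : ∀ i, ∀ᵐ t ∂(volume.restrict (Set.Icc t₀ τ)),
    ∃ v ∈ P.zhDot (X t) i, HasDerivAt (fun t => (X t).zh i) v t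

/-! ### Error signals -/

/-- `ζ_i1 = x_i - x̂_i`. -/
def State.ζ₁ (s : State N) (i : Fin N) : Plane := s.x i - s.xh i

/-- `ζ_i2 = z_i - ẑ_i`. -/
def Loop.ζ₂ (P : Loop N) (t : ℝ) (s : State N) (i : Fin N) : Plane := P.z t s i - s.zh i

/-- `η_ij = y_ij - x_j`. -/
def State.η (s : State N) (i j : Fin N) : Plane := s.y i j - s.x j

/-- `ξ_i = x_i - x_i^*`. -/
def State.ξ (s : State N) (xs : Profile N) (i : Fin N) : Plane := s.x i - xs i

/-- The filtered signal `γ_i = (d/dt) ζ_i1 + c_i ζ_i1`, the derivative being the one prescribed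
by the closed loop. -/
def Loop.γ (P : Loop N) (t : ℝ) (s : State N) (i : Fin N) : Plane :=
  (P.xDot t s i - P.xhDot s i) + P.K.c i • s.ζ₁ i

/-- The Euclidean norm of the stacked error vector `𝓔_f = (ζ₁, ζ₂, η, ξ, γ)`. -/
def Loop.errNorm (P : Loop N) (xs : Profile N) (t : ℝ) (s : State N) : ℝ :=
  √((∑ i, ‖s.ζ₁ i‖ ^ 2) + (∑ i, ‖P.ζ₂ t s i‖ ^ 2) + (∑ i, ∑ j, ‖s.η i j‖ ^ 2)
    + (∑ i, ‖s.ξ xs i‖ ^ 2) + ∑ i, ‖P.γ t s i‖ ^ 2)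

end

end SensorSeeking

open SensorSeeking

/-!
In the coordinates `p = x̂ - x*`, `q = y - x̂`, `e = x - x̂` and `ψᵢ = gᵢ(x̂) + dᵢ - ẑᵢ - kᵢˢ eᵢ`
the signum enters the equation of `ψ` alone. The Lyapunov function
`V = ∑ uᵢ ‖pᵢ‖² + ∑ ‖qᵢⱼ‖² / θ̄ᵢⱼ + λ ∑ (‖ψᵢ‖² / (2βᵢ) + ‖eᵢ‖₁ - ⟨eᵢ, ḋᵢ⟩ / βᵢ)`
is built so that the derivative of the `ℓ¹` norm cancels the signum term `⟨ψᵢ, sgn eᵢ⟩` and the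
inner product with `ḋᵢ` cancels the disturbance. The linear part of the cost gradients is
diagonally dominant, and the inverse of the M-matrix of its row bounds supplies weights `uᵢ` making
the weighted game strongly monotone. The grounded Laplacians of a connected graph are coercive, so a
large `θ` dissipates `q`. All constants are valid only on a ball, which the trajectory cannot leave
because `V` decreases in it; then `V` decays exponentially.
-/

namespace SensorSeeking

section AbsoluteContinuity

variable {E F : Type*} [SeminormedAddCommGroup E] [SeminormedAddCommGroup F] {a b : ℝ}

theorem absolutelyContinuous_comp {f : ℝ → E} {φ : E → F} (hφ : LocallyLipschitz φ)
    (hf : AbsolutelyContinuousOnInterval f a b) :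
    AbsolutelyContinuousOnInterval (fun t => φ (f t)) a b := by
  obtain ⟨K, hK⟩ := hφ.locallyLipschitzOn.exists_lipschitzOnWith_of_compact
    (isCompact_uIcc.image_of_continuousOn hf.continuousOn)
  have hlim := Tendsto.const_mul (K : ℝ) hf
  rw [mul_zero] at hlim
  refine squeeze_zero' (Eventually.of_forall fun I => Finset.sum_nonneg fun i _ => dist_nonneg)
    ?_ hlim
  filter_upwards [mem_inf_of_right (mem_principal_self _)] with I hI
  rw [Finset.mul_sum]
  exact Finset.sum_le_sum fun i hi => hK.dist_le_mul _ (Set.mem_image_of_mem f (hI.1 i hi).1) _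
    (Set.mem_image_of_mem f (hI.1 i hi).2)

theorem absolutelyContinuous_pi {ι : Type*} [Fintype ι] {f : ℝ → ι → E}
    (hf : ∀ i, AbsolutelyContinuousOnInterval (fun t => f t i) a b) :
    AbsolutelyContinuousOnInterval f a b := by
  have hlim := tendsto_finsetSum Finset.univ fun i _ => hf i
  rw [Finset.sum_const_zero] at hlim
  refine squeeze_zero (fun I => Finset.sum_nonneg fun i _ => dist_nonneg) (fun I => ?_) hlim
  rw [Finset.sum_comm]
  refine Finset.sum_le_sum fun k _ => ?_
  refine (dist_pi_le_iff (Finset.sum_nonneg fun i _ => dist_nonneg)).2 fun i => ?_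
  exact Finset.single_le_sum (f := fun i => dist (f (I.2 k).1 i) (f (I.2 k).2 i))
    (fun i _ => dist_nonneg) (Finset.mem_univ i)

theorem absolutelyContinuous_sum {ι : Type*} [Fintype ι] {f : ι → ℝ → ℝ}
    (hf : ∀ i, AbsolutelyContinuousOnInterval (f i) a b) :
    AbsolutelyContinuousOnInterval (fun t => ∑ i, f i t) a b :=
  absolutelyContinuous_comp (f := fun t i => f i t) (φ := fun v => ∑ i, v i)
    (ContDiff.sum fun i _ => contDiff_apply ℝ ℝ i).locallyLipschitz (absolutelyContinuous_pi hf)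

theorem absolutelyContinuous_abs {f : ℝ → ℝ} (hf : AbsolutelyContinuousOnInterval f a b) :
    AbsolutelyContinuousOnInterval (fun t => |f t|) a b :=
  absolutelyContinuous_comp (φ := abs) lipschitzWith_one_norm.locallyLipschitz hf

variable {H : Type*} [NormedAddCommGroup H] [InnerProductSpace ℝ H]

theorem absolutelyContinuous_norm_sq {f : ℝ → H} (hf : AbsolutelyContinuousOnInterval f a b) :
    AbsolutelyContinuousOnInterval (fun t => ‖f t‖ ^ 2) a b :=
  absolutelyContinuous_comp (φ := fun v => ‖v‖ ^ 2) (contDiff_norm_sq ℝ).locallyLipschitz hf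

theorem absolutelyContinuous_inner {f g : ℝ → H} (hf : AbsolutelyContinuousOnInterval f a b)
    (hg : AbsolutelyContinuousOnInterval g a b) :
    AbsolutelyContinuousOnInterval (fun t => inner ℝ (f t) (g t)) a b := by
  have hpol := ((absolutelyContinuous_norm_sq (hf.fun_add hg)).fun_sub
    (absolutelyContinuous_norm_sq (hf.fun_sub hg))).const_mul (1 / 4)
  refine hpol.congr fun I => ?_
  have polarization (t : ℝ) :
      (1 / 4 : ℝ) * (‖f t + g t‖ ^ 2 - ‖f t - g t‖ ^ 2) = inner ℝ (f t) (g t) := by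
    rw [norm_add_sq_real, norm_sub_sq_real]
    ring
  simp only [polarization]

end AbsoluteContinuity

section Barrier

variable {f : ℝ → ℝ} {a b : ℝ}

theorem le_of_ae_deriv_nonpos (hab : a ≤ b) (hf : AbsolutelyContinuousOnInterval f a b)
    (hderiv : ∀ᵐ t, t ∈ Set.Icc a b → ∃ f', HasDerivAt f f' t ∧ f' ≤ 0) : f b ≤ f a := by
  rw [← sub_nonpos, ← hf.integral_deriv_eq_sub, intervalIntegral.integral_of_le hab]
  refine integral_nonpos_of_ae ?_
  rw [Filter.EventuallyLE, ae_restrict_iff' measurableSet_Ioc]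
  filter_upwards [hderiv] with t ht hmem
  obtain ⟨f', hf', hle⟩ := ht (Set.Ioc_subset_Icc_self hmem)
  simpa only [hf'.deriv, Pi.zero_apply] using hle

theorem le_exp_mul_of_ae_deriv_le {α : ℝ} (hab : a ≤ b)
    (hf : AbsolutelyContinuousOnInterval f a b)
    (hderiv : ∀ᵐ t, t ∈ Set.Icc a b → ∃ f', HasDerivAt f f' t ∧ f' ≤ -α * f t) :
    f b ≤ Real.exp (-α * (b - a)) * f a := by
  have hexp : AbsolutelyContinuousOnInterval (fun t => Real.exp (α * (t - a))) a b :=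
    ContDiffOn.absolutelyContinuousOnInterval (by fun_prop)
  have hmono := le_of_ae_deriv_nonpos hab (hexp.fun_mul hf) (by
    filter_upwards [hderiv] with t ht hmem
    obtain ⟨f', hf', hle⟩ := ht hmem
    have hd : HasDerivAt (fun t => Real.exp (α * (t - a))) (Real.exp (α * (t - a)) * α) t := by
      simpa using (((hasDerivAt_id t).sub_const a).const_mul α).exp
    refine ⟨_, hd.mul hf', ?_⟩
    nlinarith [mul_nonneg (Real.exp_pos (α * (t - a))).le (sub_nonneg.2 hle)])
  have hinv : Real.exp (-α * (b - a)) = (Real.exp (α * (b - a)))⁻¹ := by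
    rw [← Real.exp_neg, neg_mul]
  rw [hinv, ← div_eq_inv_mul, le_div_iff₀ (Real.exp_pos _), mul_comm]
  simpa using hmono

theorem le_left_of_barrier {c : ℝ} (hf : AbsolutelyContinuousOnInterval f a b) (hc : f a < c)
    (hderiv : ∀ᵐ t, t ∈ Set.Icc a b → f t ≤ c → ∃ f', HasDerivAt f f' t ∧ f' ≤ 0)
    {t : ℝ} (ht : t ∈ Set.Icc a b) : f t ≤ f a := by
  have hab : a ≤ b := ht.1.trans ht.2
  have hcont : ContinuousOn f (Set.Icc a b) := by simpa [Set.uIcc_of_le hab] using hf.continuousOn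
  suffices hsub : Set.Icc a b ⊆ {t | f t ≤ f a} from hsub ht
  refine IsClosed.Icc_subset_of_forall_mem_nhdsWithin ?_ (le_refl (f a)) ?_
  · rw [Set.inter_comm]
    exact hcont.preimage_isClosed_of_isClosed isClosed_Icc isClosed_Iic
  · rintro x ⟨hx : f x ≤ f a, hxI⟩
    have hnear : ∀ᶠ y in 𝓝[Set.Icc a b] x, f y < c :=
      (hcont x ⟨hxI.1, hxI.2.le⟩).eventually (gt_mem_nhds (hx.trans_lt hc))
    rw [eventually_nhdsWithin_iff] at hnear
    obtain ⟨ε, hε, hball⟩ := Metric.eventually_nhds_iff.1 hnear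
    filter_upwards [Ioo_mem_nhdsGT (lt_min hxI.2 (lt_add_of_pos_right x hε))] with y hy
    obtain ⟨hyb, hyε⟩ := lt_min_iff.1 hy.2
    have hsub : Set.Icc x y ⊆ Set.Icc a b := Set.Icc_subset_Icc hxI.1 hyb.le
    refine (le_of_ae_deriv_nonpos hy.1.le (hf.mono ?_) ?_).trans hx
    · rwa [Set.uIcc_of_le hy.1.le, Set.uIcc_of_le hab]
    · filter_upwards [hderiv] with s hs hsI
      refine hs (hsub hsI) (hball ?_ (hsub hsI)).le
      rw [Real.dist_eq, abs_of_nonneg (by linarith [hsI.1])]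
      linarith [hsI.2]

theorem le_exp_mul_of_barrier {α c : ℝ} (hα : 0 ≤ α) (hf : AbsolutelyContinuousOnInterval f a b)
    (hc : f a < c)
    (hderiv : ∀ᵐ t, t ∈ Set.Icc a b → f t ≤ c →
      0 ≤ f t ∧ ∃ f', HasDerivAt f f' t ∧ f' ≤ -α * f t)
    {t : ℝ} (ht : t ∈ Set.Icc a b) : f t ≤ Real.exp (-α * (t - a)) * f a := by
  have hsub : Set.Icc a t ⊆ Set.Icc a b := Set.Icc_subset_Icc le_rfl ht.2
  refine le_exp_mul_of_ae_deriv_le ht.1 (hf.mono ?_) ?_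
  · rwa [Set.uIcc_of_le ht.1, Set.uIcc_of_le (ht.1.trans ht.2)]
  · filter_upwards [hderiv] with s hs hsI
    refine (hs (hsub hsI) ((le_left_of_barrier hf hc ?_ (hsub hsI)).trans hc.le)).2
    filter_upwards [hderiv] with r hr hrI hrc
    obtain ⟨hnonneg, f', hf', hle⟩ := hr hrI hrc
    exact ⟨f', hf', hle.trans (mul_nonpos_of_nonpos_of_nonneg (neg_nonpos.2 hα) hnonneg)⟩

end Barrier

section MMatrix

variable {n : Type*} [Fintype n] {w : n → n → ℝ} {ρ : n → ℝ}

/-- The operator `y ↦ (ρ i * y i + ∑ k, w i k * (y i - y k))ᵢ`, whose matrix is a row diagonally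
dominant M-matrix when `0 ≤ w` and `0 < ρ`. -/
def dominantOperator (w : n → n → ℝ) (ρ : n → ℝ) : (n → ℝ) →ₗ[ℝ] (n → ℝ) :=
  let π (i : n) : (n → ℝ) →ₗ[ℝ] ℝ := LinearMap.proj i
  LinearMap.pi fun i => ρ i • π i + ∑ k, w i k • (π i - π k)

theorem dominantOperator_apply (y : n → ℝ) (i : n) :
    dominantOperator w ρ y i = ρ i * y i + ∑ k, w i k * (y i - y k) := by
  simp [dominantOperator]

theorem nonneg_of_dominantOperator_nonneg (hw : ∀ i j, 0 ≤ w i j) (hρ : ∀ i, 0 < ρ i) {y : n → ℝ}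
    (hy : 0 ≤ dominantOperator w ρ y) : 0 ≤ y := by
  intro i
  obtain ⟨m, -, hm⟩ := Finset.exists_min_image Finset.univ y ⟨i, Finset.mem_univ i⟩
  have hdiff : ∑ k, w m k * (y m - y k) ≤ 0 := Finset.sum_nonpos fun k _ =>
    mul_nonpos_of_nonneg_of_nonpos (hw m k) (sub_nonpos.2 (hm k (Finset.mem_univ k)))
  have hrow := hy m
  rw [Pi.zero_apply, dominantOperator_apply] at hrow
  have hym : 0 ≤ y m := nonneg_of_mul_nonneg_right (by linarith) (hρ m)
  exact hym.trans (hm i (Finset.mem_univ i))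

theorem dominantOperator_injective (hw : ∀ i j, 0 ≤ w i j) (hρ : ∀ i, 0 < ρ i) :
    Function.Injective (dominantOperator w ρ) := by
  refine (injective_iff_map_eq_zero _).2 fun y hy => le_antisymm ?_ ?_
  · refine neg_nonneg.1 (nonneg_of_dominantOperator_nonneg hw hρ ?_)
    rw [map_neg, hy, neg_zero]
  · exact nonneg_of_dominantOperator_nonneg hw hρ hy.ge

theorem exists_pos_dominantOperator_sum_eq (hw : ∀ i j, 0 ≤ w i j) (hρ : ∀ i, 0 < ρ i) :
    ∃ u : n → ℝ, (∀ i, 0 < u i) ∧ ∀ y, ∑ i, u i * dominantOperator w ρ y i = ∑ i, y i := by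
  classical
  let T := LinearEquiv.ofInjectiveEndo _ (dominantOperator_injective hw hρ)
  let S : (n → ℝ) →ₗ[ℝ] ℝ := (∑ j, LinearMap.proj j) ∘ₗ T.symm.toLinearMap
  have hS (z : n → ℝ) : S z = ∑ j, T.symm z j := by simp [S]
  refine ⟨fun i => S (Pi.single i 1), fun i => ?_, fun y => ?_⟩
  · have hcol : dominantOperator w ρ (T.symm (Pi.single i 1)) = Pi.single i 1 :=
      T.apply_symm_apply _
    have hnonneg : 0 ≤ T.symm (Pi.single i 1) := nonneg_of_dominantOperator_nonneg hw hρ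
      (hcol.ge.trans' (Pi.single_nonneg.2 zero_le_one))
    simp only [hS]
    refine (Finset.sum_nonneg fun j _ => hnonneg j).lt_of_ne' fun h0 => ?_
    have hzero : T.symm (Pi.single i 1) = 0 := funext fun j =>
      (Finset.sum_eq_zero_iff_of_nonneg fun j _ => hnonneg j).1 h0 j (Finset.mem_univ j)
    rw [hzero, map_zero] at hcol
    simpa using congrFun hcol i
  · calc ∑ i, S (Pi.single i 1) * dominantOperator w ρ y i
        = S (dominantOperator w ρ y) := by
          rw [LinearMap.pi_apply_eq_sum_univ S]
          refine Finset.sum_congr rfl fun i _ => ?_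
          rw [smul_eq_mul, mul_comm]
          congr 2
          ext j
          simp [Pi.single_apply, eq_comm]
      _ = ∑ i, y i := by
          rw [hS]
          exact congrArg (fun v : n → ℝ => ∑ i, v i) (T.symm_apply_apply y)

end MMatrix

section Homogeneous

variable {E : Type*} [NormedAddCommGroup E] [NormedSpace ℝ E] [FiniteDimensional ℝ E]

theorem exists_pos_mul_le_of_homogeneous {Q R : E → ℝ} (hQ : Continuous Q) (hR : Continuous R)
    (hQhom : ∀ (r : ℝ) x, Q (r • x) = r ^ 2 * Q x) (hRhom : ∀ (r : ℝ) x, R (r • x) = r ^ 2 * R x)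
    (hpos : ∀ x ≠ 0, 0 < Q x) : ∃ m > 0, ∀ x, m * R x ≤ Q x := by
  have hne (x : E) (hx : x ∈ Metric.sphere (0 : E) 1) : 0 < Q x :=
    hpos x (ne_zero_of_mem_unit_sphere ⟨x, hx⟩)
  have := FiniteDimensional.proper ℝ E
  obtain ⟨C, hC⟩ := (isCompact_sphere (0 : E) 1).bddAbove_image
    (hR.continuousOn.div hQ.continuousOn fun x hx => (hne x hx).ne')
  refine ⟨(max C 1)⁻¹, by positivity, fun x => (inv_mul_le_iff₀ (by positivity)).2 ?_⟩
  rcases eq_or_ne x 0 with rfl | hx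
  · have hQ0 := hQhom 0 0
    have hR0 := hRhom 0 0
    simp only [smul_zero, ne_eq, OfNat.ofNat_ne_zero, not_false_eq_true, zero_pow,
      zero_mul] at hQ0 hR0
    rw [hQ0, hR0, mul_zero]
  · have hunit : ‖x‖⁻¹ • x ∈ Metric.sphere (0 : E) 1 := by
      simp [norm_smul, norm_ne_zero_iff.2 hx]
    have hratio : R (‖x‖⁻¹ • x) / Q (‖x‖⁻¹ • x) ≤ C := hC ⟨_, hunit, rfl⟩
    have hnorm : (‖x‖⁻¹) ^ 2 ≠ 0 := by simpa using hx
    rw [hQhom, hRhom, mul_div_mul_left _ _ hnorm, div_le_iff₀ (hpos x hx)] at hratio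
    exact hratio.trans (mul_le_mul_of_nonneg_right (le_max_left _ _) (hpos x hx).le)

end Homogeneous

theorem pi_norm_sq_le {ι E : Type*} [Fintype ι] [SeminormedAddCommGroup E] {v : ι → E} {B : ℝ}
    (hB : 0 ≤ B) (h : ∀ i, ‖v i‖ ^ 2 ≤ B) : ‖v‖ ^ 2 ≤ B :=
  (Real.le_sqrt (norm_nonneg v) hB).1 <|
    (pi_norm_le_iff_of_nonneg (Real.sqrt_nonneg B)).2 fun i => Real.le_sqrt_of_sq_le (h i)

theorem norm_sq_le_sum {ι E : Type*} [Fintype ι] [SeminormedAddCommGroup E] (v : ι → E) (i : ι) :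
    ‖v i‖ ^ 2 ≤ ∑ j, ‖v j‖ ^ 2 :=
  Finset.single_le_sum (f := fun j => ‖v j‖ ^ 2) (fun _ _ => sq_nonneg _) (Finset.mem_univ i)

theorem pi_norm_sq_le_sum {ι E : Type*} [Fintype ι] [SeminormedAddCommGroup E] (v : ι → E) :
    ‖v‖ ^ 2 ≤ ∑ i, ‖v i‖ ^ 2 :=
  pi_norm_sq_le (Finset.sum_nonneg fun _ _ => sq_nonneg _) (norm_sq_le_sum v)

theorem exists_pos_mul_norm_sq_le_of_posDef {n : Type*} [Fintype n] [DecidableEq n]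
    {A : Matrix n n ℝ} (hA : A.PosDef) :
    ∃ ρ > 0, ∀ x : EuclideanSpace ℝ n,
      ρ * ‖x‖ ^ 2 ≤ inner ℝ x (Matrix.toEuclideanCLM (𝕜 := ℝ) A x) := by
  refine exists_pos_mul_le_of_homogeneous (by fun_prop) (by fun_prop) (fun r x => ?_)
    (fun r x => ?_) fun x hx => ?_
  · rw [map_smul, real_inner_smul_left, real_inner_smul_right]
    ring
  · rw [norm_smul, mul_pow, Real.norm_eq_abs, sq_abs]
  · rw [Matrix.inner_toEuclideanCLM]
    simpa using hA.dotProduct_mulVec_pos (x := x.ofLp) (by simpa using hx)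

theorem hasGradientAt_of_quadratic_remainder {E : Type*} [NormedAddCommGroup E]
    [InnerProductSpace ℝ E] [CompleteSpace E] {f : E → ℝ} {x g : E} (C : ℝ)
    (hf : ∀ h, |f (x + h) - f x - inner ℝ g h| ≤ C * ‖h‖ ^ 2) : HasGradientAt f g x := by
  rw [hasGradientAt_iff_isLittleO_nhds_zero]
  have hO : (fun h => f (x + h) - f x - inner ℝ g h) =O[𝓝 0] fun h => ‖h‖ ^ 2 :=
    Asymptotics.IsBigO.of_bound C <| Eventually.of_forall fun h => by simpa using hf h
  refine hO.trans_isLittleO ?_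
  simpa using Asymptotics.isLittleO_norm_pow_id (E' := E) one_lt_two

/-- `xs` is a critical point of the pseudo-gradient of the game `f`. The pseudo-gradient has
squared Lipschitz constant `L` and, with the components of player `i` weighted by `u i`, is strongly
monotone about `xs`. -/
structure IsDiagonallyStableAt (f : Fin N → Profile N → ℝ) (xs : Profile N) (u : Fin N → ℝ)
    (L : ℝ) : Prop where
  ownGradient_eq_zero : ∀ i, ownGradient f i xs = 0
  lipschitz_nonneg : 0 ≤ L
  norm_sub_sq_le : ∀ i v w,
    ‖ownGradient f i v - ownGradient f i w‖ ^ 2 ≤ L * ∑ j, ‖v j - w j‖ ^ 2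
  weight_pos : ∀ i, 0 < u i
  sum_norm_sub_sq_le : ∀ v,
    ∑ i, ‖v i - xs i‖ ^ 2 ≤ ∑ i, u i * inner ℝ (v i - xs i) (ownGradient f i v)

namespace ConnectivityGame

variable (G : ConnectivityGame N) (i : Fin N)

/-- The weight `c_ij`, extended by zero to the pairs that are not neighbours. -/
noncomputable def weight (j : Fin N) : ℝ := if j ∈ G.nbr i then G.w i j else 0

theorem weight_nonneg (j : Fin N) : 0 ≤ G.weight i j := by
  unfold weight
  split_ifs with h
  exacts [(G.w_pos i j h).le, le_rfl]

/-- The matrix `r_ii` as an operator of the plane. -/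
noncomputable def rOp : Plane →L[ℝ] Plane := Matrix.toEuclideanCLM (𝕜 := ℝ) (G.r i)

theorem inner_rOp_comm (x y : Plane) : inner ℝ x (G.rOp i y) = inner ℝ y (G.rOp i x) := by
  have hsymm := Matrix.isSymmetric_toEuclideanLin_iff.2 (G.posDef i).isHermitian
  rw [real_inner_comm]
  exact hsymm y x

theorem cost_eq (x : Profile N) :
    G.cost i x = inner ℝ (x i) (G.rOp i (x i)) + inner ℝ (G.q i) (x i) + G.b i +
      ∑ j, G.weight i j * ‖x i - x j‖ ^ 2 := by
  rw [cost, rOp, Matrix.inner_toEuclideanCLM, EuclideanSpace.inner_eq_star_dotProduct]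
  simp [weight, ite_mul, Finset.sum_ite_mem]

/-- The linear part of the `i`-th component of the pseudo-gradient. -/
noncomputable def hess : Profile N →L[ℝ] Plane :=
  let π (j : Fin N) : Profile N →L[ℝ] Plane := ContinuousLinearMap.proj j
  (2 : ℝ) • (G.rOp i ∘L π i + ∑ j, G.weight i j • (π i - π j))

theorem hess_apply (v : Profile N) :
    G.hess i v = (2 : ℝ) • (G.rOp i (v i) + ∑ j, G.weight i j • (v i - v j)) := by
  simp [hess]

/-- The second-order term of the cost of sensor `i` under a displacement `h` of that sensor. -/
noncomputable def curvature (h : Plane) : ℝ :=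
  inner ℝ h (G.rOp i h) + ∑ j ∈ Finset.univ.erase i, G.weight i j * ‖h‖ ^ 2

theorem curvature_nonneg (h : Plane) : 0 ≤ G.curvature i h := by
  obtain ⟨ρ, hρ, hr⟩ := exists_pos_mul_norm_sq_le_of_posDef (G.posDef i)
  exact add_nonneg (le_trans (by positivity) (hr h))
    (Finset.sum_nonneg fun j _ => mul_nonneg (G.weight_nonneg i j) (sq_nonneg _))

theorem curvature_le (h : Plane) :
    G.curvature i h ≤ (‖G.rOp i‖ + ∑ j ∈ Finset.univ.erase i, G.weight i j) * ‖h‖ ^ 2 := by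
  rw [curvature, add_mul, Finset.sum_mul]
  gcongr
  calc inner ℝ h (G.rOp i h) ≤ ‖h‖ * ‖G.rOp i h‖ := real_inner_le_norm _ _
    _ ≤ ‖h‖ * (‖G.rOp i‖ * ‖h‖) := by gcongr; exact (G.rOp i).le_opNorm h
    _ = ‖G.rOp i‖ * ‖h‖ ^ 2 := by ring

theorem sum_weight_update (v : Profile N) (h : Plane) :
    ∑ j, G.weight i j *
        ‖Function.update v i (v i + h) i - Function.update v i (v i + h) j‖ ^ 2 =
      ∑ j, G.weight i j * ‖v i - v j‖ ^ 2 + 2 * inner ℝ (∑ j, G.weight i j • (v i - v j)) h +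
        ∑ j ∈ Finset.univ.erase i, G.weight i j * ‖h‖ ^ 2 := by
  simp only [← Finset.add_sum_erase Finset.univ _ (Finset.mem_univ i), sub_self, smul_zero,
    norm_zero, zero_add, ne_eq, OfNat.ofNat_ne_zero, not_false_eq_true, zero_pow, mul_zero,
    sum_inner, Finset.mul_sum, ← Finset.sum_add_distrib]
  refine Finset.sum_congr rfl fun j hj => ?_
  rw [Function.update_self, Function.update_of_ne (Finset.ne_of_mem_erase hj),
    add_sub_right_comm, norm_add_sq_real, real_inner_smul_left]
  ring

theorem cost_update (v : Profile N) (h : Plane) :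
    G.cost i (Function.update v i (v i + h)) =
      G.cost i v + inner ℝ (G.hess i v + G.q i) h + G.curvature i h := by
  rw [cost_eq, sum_weight_update, Function.update_self, cost_eq, hess_apply, curvature, map_add]
  simp only [inner_add_left, inner_add_right, real_inner_smul_left]
  rw [G.inner_rOp_comm i (v i) h, real_inner_comm h (G.rOp i (v i))]
  ring

theorem hasGradientAt_cost (v : Profile N) :
    HasGradientAt (fun w => G.cost i (Function.update v i w)) (G.hess i v + G.q i) (v i) := by
  refine hasGradientAt_of_quadratic_remainder
    (‖G.rOp i‖ + ∑ j ∈ Finset.univ.erase i, G.weight i j) fun h => ?_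
  rw [cost_update, Function.update_eq_self, add_assoc, add_sub_cancel_left, add_sub_cancel_left,
    abs_of_nonneg (G.curvature_nonneg i h)]
  exact G.curvature_le i h

theorem ownGradient_cost (v : Profile N) : ownGradient G.cost i v = G.hess i v + G.q i :=
  (G.hasGradientAt_cost i v).gradient

theorem isNash_iff (xs : Profile N) : IsNash G.cost xs ↔ ∀ i, G.hess i xs + G.q i = 0 := by
  constructor
  · intro hNash i
    have hmin : IsLocalMin (fun w => G.cost i (Function.update xs i w)) (xs i) :=
      Eventually.of_forall fun w => by
        simpa only [Function.update_eq_self] using hNash i w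
    exact (InnerProductSpace.toDual ℝ Plane).map_eq_zero_iff.1
      (hmin.hasFDerivAt_eq_zero (G.hasGradientAt_cost i xs).hasFDerivAt)
  · intro hzero i w
    have hcost := G.cost_update i xs (w - xs i)
    rw [add_sub_cancel, hzero i, inner_zero_left] at hcost
    linarith [G.curvature_nonneg i (w - xs i)]

theorem exists_dominantOperator_le_inner_hess :
    ∃ ρ : Fin N → ℝ, (∀ i, 0 < ρ i) ∧ ∀ i (v : Profile N),
      dominantOperator G.weight ρ (fun j => ‖v j‖ ^ 2) i ≤ inner ℝ (v i) (G.hess i v) := by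
  choose ρ hρ hr using fun i => exists_pos_mul_norm_sq_le_of_posDef (G.posDef i)
  refine ⟨fun i => 2 * ρ i, fun i => mul_pos two_pos (hρ i), fun i v => ?_⟩
  rw [dominantOperator_apply, hess_apply, real_inner_smul_right, inner_add_right, inner_sum,
    mul_add, Finset.mul_sum, mul_assoc]
  refine add_le_add (mul_le_mul_of_nonneg_left (hr i (v i)) two_pos.le)
    (Finset.sum_le_sum fun j _ => ?_)
  have hpair : ‖v i‖ ^ 2 - ‖v j‖ ^ 2 ≤ 2 * inner ℝ (v i) (v i - v j) := by
    rw [inner_sub_right, real_inner_self_eq_norm_sq]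
    nlinarith [norm_sub_sq_real (v i) (v j), sq_nonneg ‖v i - v j‖]
  rw [real_inner_smul_right]
  linarith [mul_le_mul_of_nonneg_left hpair (G.weight_nonneg i j)]

theorem exists_weights_sum_norm_sq_le :
    ∃ u : Fin N → ℝ, (∀ i, 0 < u i) ∧
      ∀ v : Profile N, ∑ i, ‖v i‖ ^ 2 ≤ ∑ i, u i * inner ℝ (v i) (G.hess i v) := by
  obtain ⟨ρ, hρ, hhess⟩ := G.exists_dominantOperator_le_inner_hess
  obtain ⟨u, hu, hsum⟩ := exists_pos_dominantOperator_sum_eq G.weight_nonneg hρ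
  refine ⟨u, hu, fun v => ?_⟩
  rw [← hsum fun j => ‖v j‖ ^ 2]
  exact Finset.sum_le_sum fun i _ => mul_le_mul_of_nonneg_left (hhess i v) (hu i).le

theorem existsUnique_isNash : ∃! xs : Profile N, IsNash G.cost xs := by
  let H : Profile N →ₗ[ℝ] Profile N := LinearMap.pi fun i => (G.hess i).toLinearMap
  obtain ⟨u, -, hu⟩ := G.exists_weights_sum_norm_sq_le
  have hinj : Function.Injective H := (injective_iff_map_eq_zero H).2 fun v hv => by
    have hzero (i : Fin N) : G.hess i v = 0 := congrFun hv i
    have hsum := (pi_norm_sq_le_sum v).trans (hu v)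
    simp only [hzero, inner_zero_right, mul_zero, Finset.sum_const_zero] at hsum
    exact norm_eq_zero.1 (sq_eq_zero_iff.1 (hsum.antisymm (sq_nonneg _)))
  obtain ⟨xs, hxs⟩ := LinearMap.injective_iff_surjective.1 hinj fun i => -G.q i
  refine ⟨xs, (G.isNash_iff xs).2 fun i => ?_, fun y hy => hinj (hxs.symm ▸ funext fun i => ?_)⟩
  · exact add_eq_zero_iff_eq_neg.2 (congrFun hxs i)
  · exact add_eq_zero_iff_eq_neg.1 ((G.isNash_iff y).1 hy i)

theorem exists_norm_hess_sq_le :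
    ∃ L ≥ 0, ∀ i (v : Profile N), ‖G.hess i v‖ ^ 2 ≤ L * ∑ j, ‖v j‖ ^ 2 := by
  obtain ⟨L, hL⟩ := Finite.exists_le fun i => ‖G.hess i‖ ^ 2
  refine ⟨max L 0, le_max_right L 0, fun i v => ?_⟩
  calc ‖G.hess i v‖ ^ 2 ≤ (‖G.hess i‖ * ‖v‖) ^ 2 := by gcongr; exact (G.hess i).le_opNorm v
    _ = ‖G.hess i‖ ^ 2 * ‖v‖ ^ 2 := mul_pow ..
    _ ≤ max L 0 * ∑ j, ‖v j‖ ^ 2 := mul_le_mul ((hL i).trans (le_max_left L 0))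
        (pi_norm_sq_le_sum v) (sq_nonneg _) (le_max_right L 0)

theorem exists_isDiagonallyStableAt {xs : Profile N} (hxs : IsNash G.cost xs) :
    ∃ u L, IsDiagonallyStableAt G.cost xs u L := by
  obtain ⟨u, hu, hmono⟩ := G.exists_weights_sum_norm_sq_le
  obtain ⟨L, hL₀, hL⟩ := G.exists_norm_hess_sq_le
  have hzero := (G.isNash_iff xs).1 hxs
  refine ⟨u, L, fun i => (G.ownGradient_cost i xs).trans (hzero i), hL₀, fun i v w => ?_, hu,
    fun v => ?_⟩
  · rw [ownGradient_cost, ownGradient_cost, add_sub_add_right_eq_sub, ← map_sub]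
    exact hL i (v - w)
  · have hgrad (i : Fin N) : ownGradient G.cost i v = G.hess i (v - xs) := by
      rw [ownGradient_cost, map_sub, eq_neg_of_add_eq_zero_right (hzero i), ← sub_eq_add_neg]
    simpa only [hgrad, Pi.sub_apply] using hmono (v - xs)

end ConnectivityGame

namespace CommGraph

variable (A : CommGraph N)

/-- The Laplacian of the communication graph grounded through the weights `a_ij` of the node `j`.
The estimates `y_ij` of the position of `j` are driven by it. -/
noncomputable def groundedLaplacian (j : Fin N) (v : Profile N) (i : Fin N) : Plane :=
  (∑ k, A.a i k • (v i - v k)) + A.a i j • v i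

theorem sum_inner_laplacian (v : Profile N) :
    2 * ∑ i, ∑ k, A.a i k * inner ℝ (v i) (v i - v k) = ∑ i, ∑ k, A.a i k * ‖v i - v k‖ ^ 2 := by
  have hswap : ∑ i, ∑ k, A.a i k * inner ℝ (v i) (v i - v k) =
      -∑ i, ∑ k, A.a i k * inner ℝ (v k) (v i - v k) := by
    rw [Finset.sum_comm, ← Finset.sum_neg_distrib]
    refine Finset.sum_congr rfl fun i _ => ?_
    rw [← Finset.sum_neg_distrib]
    refine Finset.sum_congr rfl fun k _ => ?_
    rw [A.symm, ← neg_sub, inner_neg_right, mul_neg]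
  calc 2 * ∑ i, ∑ k, A.a i k * inner ℝ (v i) (v i - v k)
      = (∑ i, ∑ k, A.a i k * inner ℝ (v i) (v i - v k)) -
          ∑ i, ∑ k, A.a i k * inner ℝ (v k) (v i - v k) := by rw [two_mul]; nth_rw 2 [hswap]; ring
    _ = ∑ i, ∑ k, A.a i k * ‖v i - v k‖ ^ 2 := by
      simp only [← Finset.sum_sub_distrib, ← mul_sub, ← inner_sub_left, real_inner_self_eq_norm_sq]

theorem two_mul_sum_inner_groundedLaplacian (j : Fin N) (v : Profile N) :
    2 * ∑ i, inner ℝ (v i) (A.groundedLaplacian j v i) =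
      (∑ i, ∑ k, A.a i k * ‖v i - v k‖ ^ 2) + 2 * ∑ i, A.a i j * ‖v i‖ ^ 2 := by
  simp only [groundedLaplacian, inner_add_right, inner_sum, real_inner_smul_right,
    Finset.sum_add_distrib, real_inner_self_eq_norm_sq, mul_add, sum_inner_laplacian]

theorem eq_of_sum_sq_eq_zero {v : Profile N} (h : ∑ i, ∑ k, A.a i k * ‖v i - v k‖ ^ 2 = 0)
    (i k : Fin N) : v i = v k := by
  have hterm (i k : Fin N) : 0 ≤ A.a i k * ‖v i - v k‖ ^ 2 :=
    mul_nonneg (A.nonneg i k) (sq_nonneg _)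
  have hedge (i k : Fin N) (hik : 0 < A.a i k) : v i = v k := by
    have hrow := (Fintype.sum_eq_zero_iff_of_nonneg
      fun i => Finset.sum_nonneg fun k _ => hterm i k).1 h
    have hzero := congrFun ((Fintype.sum_eq_zero_iff_of_nonneg (hterm i)).1 (congrFun hrow i)) k
    exact sub_eq_zero.1
      (norm_eq_zero.1 (sq_eq_zero_iff.1 ((mul_eq_zero.1 hzero).resolve_left hik.ne')))
  obtain ⟨W⟩ := A.connected.preconnected i k
  induction W with
  | nil => rfl
  | cons hadj _ ih =>
    rw [SimpleGraph.fromRel_adj] at hadj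
    exact (hadj.2.elim (hedge _ _) fun h => (hedge _ _ h).symm).trans ih

theorem exists_pos_weight (hN : 2 ≤ N) (j : Fin N) : ∃ k, 0 < A.a k j := by
  have : Nontrivial (Fin N) := Fin.nontrivial_iff_two_le.2 hN
  obtain ⟨k, hk⟩ := A.connected.preconnected.exists_adj_of_nontrivial j
  rw [SimpleGraph.fromRel_adj] at hk
  exact ⟨k, hk.2.elim (fun h => A.symm j k ▸ h) id⟩

theorem sum_inner_groundedLaplacian_pos (hN : 2 ≤ N) (j : Fin N) {v : Profile N} (hv : v ≠ 0) :
    0 < ∑ i, inner ℝ (v i) (A.groundedLaplacian j v i) := by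
  by_contra! hle
  have henergy := A.two_mul_sum_inner_groundedLaplacian j v
  have hdiff : 0 ≤ ∑ i, ∑ k, A.a i k * ‖v i - v k‖ ^ 2 := Finset.sum_nonneg fun i _ =>
    Finset.sum_nonneg fun k _ => mul_nonneg (A.nonneg i k) (sq_nonneg _)
  have hgrd (i : Fin N) : 0 ≤ A.a i j * ‖v i‖ ^ 2 := mul_nonneg (A.nonneg i j) (sq_nonneg _)
  have hsum := Finset.sum_nonneg fun i (_ : i ∈ Finset.univ) => hgrd i
  have hconst := A.eq_of_sum_sq_eq_zero (v := v) (by linarith)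
  obtain ⟨k, hk⟩ := A.exists_pos_weight hN j
  have hsum₀ : ∑ i, A.a i j * ‖v i‖ ^ 2 = 0 := by linarith
  have hzero := congrFun ((Fintype.sum_eq_zero_iff_of_nonneg hgrd).1 hsum₀) k
  have hvk : v k = 0 :=
    norm_eq_zero.1 (sq_eq_zero_iff.1 ((mul_eq_zero.1 hzero).resolve_left hk.ne'))
  exact hv (funext fun i => (hconst i k).trans hvk)

theorem exists_pos_mul_sum_norm_sq_le (hN : 2 ≤ N) : ∃ μ > 0, ∀ (j : Fin N) (v : Profile N),
    μ * ∑ i, ‖v i‖ ^ 2 ≤ ∑ i, inner ℝ (v i) (A.groundedLaplacian j v i) := by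
  have hcol (j : Fin N) : ∃ m > 0, ∀ v : Profile N,
      m * ∑ i, ‖v i‖ ^ 2 ≤ ∑ i, inner ℝ (v i) (A.groundedLaplacian j v i) := by
    refine exists_pos_mul_le_of_homogeneous (by unfold groundedLaplacian; fun_prop) (by fun_prop)
      (fun r v => ?_) (fun r v => ?_) fun v hv => A.sum_inner_groundedLaplacian_pos hN j hv
    · simp only [groundedLaplacian, Pi.smul_apply, Finset.mul_sum, ← smul_sub, smul_comm _ r,
        ← Finset.smul_sum, ← smul_add, real_inner_smul_left, real_inner_smul_right, sq, mul_assoc]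
    · simp only [Pi.smul_apply, norm_smul, mul_pow, Real.norm_eq_abs, sq_abs, ← Finset.mul_sum]
  choose m hm hle using hcol
  obtain ⟨μ, hμ, hμm⟩ := Pi.exists_forall_pos_add_lt hm
  refine ⟨μ, hμ, fun j v => le_trans ?_ (hle j v)⟩
  have : μ ≤ m j := by simpa using (hμm j).le
  gcongr

end CommGraph

section Young

variable {E : Type*} [NormedAddCommGroup E] [InnerProductSpace ℝ E] (x y : E) {b B : ℝ}

theorem two_mul_inner_le {δ : ℝ} (hb : 0 ≤ b) (hbB : b ≤ B) (hδ : 0 < δ) :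
    2 * b * inner ℝ x y ≤ δ * ‖y‖ ^ 2 + B ^ 2 / δ * ‖x‖ ^ 2 := by
  have hsq : 0 ≤ (δ * ‖y‖ - B * ‖x‖) ^ 2 / δ := by positivity
  calc 2 * b * inner ℝ x y ≤ 2 * b * (‖x‖ * ‖y‖) := by gcongr; exact real_inner_le_norm x y
    _ ≤ 2 * B * (‖x‖ * ‖y‖) := by gcongr
    _ ≤ 2 * B * (‖x‖ * ‖y‖) + (δ * ‖y‖ - B * ‖x‖) ^ 2 / δ := le_add_of_nonneg_right hsq
    _ = δ * ‖y‖ ^ 2 + B ^ 2 / δ * ‖x‖ ^ 2 := by field_simp; ring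

theorem two_mul_inner_le_of_norm_le {R : ℝ} (hb : 0 ≤ b) (hbB : b ≤ B) (hx : ‖x‖ ≤ R) :
    2 * b * inner ℝ x y ≤ 2 * B * R * ‖y‖ := by
  have hB := hb.trans hbB
  calc 2 * b * inner ℝ x y ≤ 2 * b * (‖x‖ * ‖y‖) := by gcongr; exact real_inner_le_norm x y
    _ ≤ 2 * B * (R * ‖y‖) := by gcongr
    _ = 2 * B * R * ‖y‖ := by ring

end Young

/-- The deviation `x̂_i - x*_i` of the observed position from the equilibrium. -/
noncomputable def State.ξh (s : State N) (xs : Profile N) (i : Fin N) : Plane := s.xh i - xs i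

/-- The deviation `y_ij - x̂_j` of the position estimates from the observed positions. -/
noncomputable def State.ηh (s : State N) (i j : Fin N) : Plane := s.y i j - s.xh j

theorem State.ξh_add_ζ₁ (s : State N) (xs : Profile N) (i : Fin N) :
    s.ξh xs i + s.ζ₁ i = s.ξ xs i :=
  sub_add_sub_cancel' _ _ _

theorem State.ηh_sub_ζ₁ (s : State N) (i j : Fin N) : s.ηh i j - s.ζ₁ j = s.η i j :=
  sub_sub_sub_cancel_right _ _ _

/-- The squared norm of the observed formation error `(ξ̂, η̂)`. -/
noncomputable def State.formationNormSq (s : State N) (xs : Profile N) : ℝ :=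
  ∑ i, ‖s.ξh xs i‖ ^ 2 + ∑ i, ∑ j, ‖s.ηh i j‖ ^ 2

/-- The shifted position errors of the state are all bounded by `R`. -/
structure State.ConfinedTo (s : State N) (xs : Profile N) (R : ℝ) : Prop where
  ξh_le : ∀ i, ‖s.ξh xs i‖ ≤ R
  ηh_le : ∀ i j, ‖s.ηh i j‖ ≤ R
  ζ₁_le : ∀ i, ‖s.ζ₁ i‖ ≤ R

/-- Bounds `m` and `U` for the weights `u_i` and `1 / θbar_ij` of the formation energy, and for the
weights of the communication graph. -/
structure WeightBounds (A : CommGraph N) (θbar : Fin N → Fin N → ℝ) (u : Fin N → ℝ) (m U : ℝ) :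
    Prop where
  lower_pos : 0 < m
  le_weight : ∀ i, m ≤ u i
  weight_le : ∀ i, u i ≤ U
  le_inv : ∀ i j, m ≤ (θbar i j)⁻¹
  inv_le : ∀ i j, (θbar i j)⁻¹ ≤ U
  adj_le : ∀ i j, A.a i j ≤ U

theorem exists_weightBounds (A : CommGraph N) {θbar : Fin N → Fin N → ℝ}
    (hθbar : ∀ i j, 0 < θbar i j) {u : Fin N → ℝ} (hu : ∀ i, 0 < u i) :
    ∃ m U, WeightBounds A θbar u m U := by
  obtain ⟨m₁, hm₁, hmu⟩ := Pi.exists_forall_pos_add_lt (x := 0) hu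
  obtain ⟨m₂, hm₂, hmθ⟩ := Pi.exists_forall_pos_add_lt (x := 0)
    fun p : Fin N × Fin N => inv_pos.2 (hθbar p.1 p.2)
  obtain ⟨U₁, hU₁⟩ := Finite.exists_le u
  obtain ⟨U₂, hU₂⟩ := Finite.exists_le fun p : Fin N × Fin N => (θbar p.1 p.2)⁻¹
  obtain ⟨U₃, hU₃⟩ := Finite.exists_le fun p : Fin N × Fin N => A.a p.1 p.2
  simp only [Pi.zero_apply, zero_add] at hmu hmθ
  refine ⟨min m₁ m₂, max U₁ (max U₂ U₃), lt_min hm₁ hm₂, fun i => ?_, fun i => ?_, fun i j => ?_,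
    fun i j => ?_, fun i j => ?_⟩
  exacts [(min_le_left _ _).trans (hmu i).le, (hU₁ i).trans (le_max_left _ _),
    (min_le_right _ _).trans (hmθ (i, j)).le,
    (hU₂ (i, j)).trans ((le_max_left _ _).trans (le_max_right _ _)),
    (hU₃ (i, j)).trans ((le_max_right _ _).trans (le_max_right _ _))]

namespace Loop

variable {P : Loop N} {s : State N} {xs : Profile N} {u : Fin N → ℝ} {L m U R : ℝ}

/-- The injection gain `k_i^s + c_i` of the position observer. -/
noncomputable def κ (P : Loop N) (i : Fin N) : ℝ := P.K.ks i + P.K.c i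

/-- The derivative of the formation energy `∑ u_i ‖ξ̂_i‖² + ∑ ‖η̂_ij‖² / θbar_ij` along the closed
loop. -/
noncomputable def formationRate (P : Loop N) (u : Fin N → ℝ) (xs : Profile N) (s : State N) : ℝ :=
  ∑ i, 2 * u i * inner ℝ (s.ξh xs i) (P.xhDot s i) +
    ∑ i, ∑ j, 2 * (P.K.θbar i j)⁻¹ * inner ℝ (s.ηh i j) (P.yDot s i j - P.xhDot s j)

theorem xhDot_eq (P : Loop N) (s : State N) (i : Fin N) :
    P.xhDot s i = -ownGradient P.f i (s.y i) + P.κ i • s.ζ₁ i := by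
  simp only [xhDot, Loop.u, κ, State.ζ₁, sub_add_cancel]

theorem yDot_eq (P : Loop N) (s : State N) (i j : Fin N) :
    P.yDot s i j = -((P.K.θ * P.K.θbar i j) •
      (P.A.groundedLaplacian j (fun k => s.ηh k j) i - P.A.a i j • s.ζ₁ j)) := by
  simp only [yDot, CommGraph.groundedLaplacian, State.ηh, State.ζ₁, sub_sub_sub_cancel_right,
    add_sub_assoc, ← smul_sub]

theorem norm_ownGradient_sub_sq_le (hs : IsDiagonallyStableAt P.f xs u L) (s : State N)
    (i : Fin N) :
    ‖ownGradient P.f i (s.y i) - ownGradient P.f i s.xh‖ ^ 2 ≤ L * ∑ k, ‖s.ηh i k‖ ^ 2 :=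
  hs.norm_sub_sq_le i (s.y i) s.xh

theorem norm_ownGradient_sq_le (hs : IsDiagonallyStableAt P.f xs u L) (s : State N) (i : Fin N) :
    ‖ownGradient P.f i s.xh‖ ^ 2 ≤ L * ∑ k, ‖s.ξh xs k‖ ^ 2 := by
  have h := hs.norm_sub_sq_le i s.xh xs
  rwa [hs.ownGradient_eq_zero, sub_zero] at h

theorem two_mul_inner_xhDot_le (hs : IsDiagonallyStableAt P.f xs u L)
    (hW : WeightBounds P.A P.K.θbar u m U) (hR : s.ConfinedTo xs R) (hκ : ∀ i, 0 ≤ P.κ i)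
    (i : Fin N) : 2 * u i * inner ℝ (s.ξh xs i) (P.xhDot s i) ≤
      -2 * (u i * inner ℝ (s.ξh xs i) (ownGradient P.f i s.xh)) + 1 / 2 * ‖s.ξh xs i‖ ^ 2 +
        2 * U ^ 2 * L * (∑ k, ‖s.ηh i k‖ ^ 2) + 2 * U * R * (P.κ i * ‖s.ζ₁ i‖) := by
  set F := ownGradient P.f i s.xh
  set F' := ownGradient P.f i (s.y i)
  have hu := (hs.weight_pos i).le
  have hgrad := two_mul_inner_le (F' - F) (-s.ξh xs i) hu (hW.weight_le i) one_half_pos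
  have hinj := two_mul_inner_le_of_norm_le _ (P.κ i • s.ζ₁ i) hu (hW.weight_le i) (hR.ξh_le i)
  have hlip := mul_le_mul_of_nonneg_left (norm_ownGradient_sub_sq_le hs s i)
    (by positivity : 0 ≤ 2 * U ^ 2)
  rw [norm_neg, inner_neg_right, real_inner_comm, inner_sub_right] at hgrad
  rw [norm_smul, Real.norm_of_nonneg (hκ i)] at hinj
  rw [xhDot_eq, inner_add_right, inner_neg_right]
  have hdiv : U ^ 2 / (1 / 2) = 2 * U ^ 2 := by ring
  rw [hdiv] at hgrad
  linarith

theorem two_mul_inner_yDot_sub_eq {i j : Fin N} (hθbar : 0 < P.K.θbar i j) :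
    2 * (P.K.θbar i j)⁻¹ * inner ℝ (s.ηh i j) (P.yDot s i j - P.xhDot s j) =
      -2 * P.K.θ * inner ℝ (s.ηh i j) (P.A.groundedLaplacian j (fun k => s.ηh k j) i) +
      2 * P.A.a i j * inner ℝ (s.ηh i j) (P.K.θ • s.ζ₁ j) +
      2 * (P.K.θbar i j)⁻¹ * inner ℝ (s.ηh i j) (ownGradient P.f j s.xh) +
      2 * (P.K.θbar i j)⁻¹ *
        inner ℝ (s.ηh i j) (ownGradient P.f j (s.y j) - ownGradient P.f j s.xh) +
      2 * (P.K.θbar i j)⁻¹ * inner ℝ (s.ηh i j) (-(P.κ j • s.ζ₁ j)) := by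
  rw [yDot_eq, xhDot_eq]
  simp only [inner_sub_right, inner_add_right, inner_neg_right, inner_smul_right]
  field_simp
  ring

theorem two_mul_inner_yDot_sub_le (hs : IsDiagonallyStableAt P.f xs u L)
    (hW : WeightBounds P.A P.K.θbar u m U) (hR : s.ConfinedTo xs R) (hκ : ∀ i, 0 ≤ P.κ i)
    (hθ : 0 ≤ P.K.θ) {δ : ℝ} (hδ : 0 < δ) (i j : Fin N) :
    2 * (P.K.θbar i j)⁻¹ * inner ℝ (s.ηh i j) (P.yDot s i j - P.xhDot s j) ≤
      -2 * P.K.θ * inner ℝ (s.ηh i j) (P.A.groundedLaplacian j (fun k => s.ηh k j) i) +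
        δ * L * (∑ k, ‖s.ξh xs k‖ ^ 2) + L * (∑ k, ‖s.ηh j k‖ ^ 2) +
        (U ^ 2 / δ + U ^ 2) * ‖s.ηh i j‖ ^ 2 + 2 * U * R * ((P.K.θ + P.κ j) * ‖s.ζ₁ j‖) := by
  have hinv : 0 < (P.K.θbar i j)⁻¹ := hW.lower_pos.trans_le (hW.le_inv i j)
  have hη := hR.ηh_le i j
  have hcons := two_mul_inner_le_of_norm_le _ (P.K.θ • s.ζ₁ j) (P.A.nonneg i j) (hW.adj_le i j) hη
  have hinj := two_mul_inner_le_of_norm_le _ (-(P.κ j • s.ζ₁ j)) hinv.le (hW.inv_le i j) hη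
  have hgrad := two_mul_inner_le (s.ηh i j) (ownGradient P.f j s.xh) hinv.le (hW.inv_le i j) hδ
  have hdiff := two_mul_inner_le (s.ηh i j)
    (ownGradient P.f j (s.y j) - ownGradient P.f j s.xh) hinv.le (hW.inv_le i j) one_pos
  have hlip := norm_ownGradient_sub_sq_le hs s j
  have hlip' := mul_le_mul_of_nonneg_left (norm_ownGradient_sq_le hs s j) hδ.le
  rw [norm_smul, Real.norm_of_nonneg hθ] at hcons
  rw [norm_neg, norm_smul, Real.norm_of_nonneg (hκ j)] at hinj
  rw [two_mul_inner_yDot_sub_eq (inv_pos.1 hinv)]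
  rw [div_one, one_mul] at hdiff
  linarith

theorem sum_two_mul_inner_xhDot_le (hs : IsDiagonallyStableAt P.f xs u L)
    (hW : WeightBounds P.A P.K.θbar u m U) (hR : s.ConfinedTo xs R) (hκ : ∀ i, 0 ≤ P.κ i) :
    ∑ i, 2 * u i * inner ℝ (s.ξh xs i) (P.xhDot s i) ≤
      -(3 / 2) * (∑ i, ‖s.ξh xs i‖ ^ 2) + 2 * U ^ 2 * L * (∑ i, ∑ j, ‖s.ηh i j‖ ^ 2) +
        2 * U * R * ∑ j, P.κ j * ‖s.ζ₁ j‖ := by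
  have hsum := Finset.sum_le_sum fun i (_ : i ∈ Finset.univ) =>
    two_mul_inner_xhDot_le hs hW hR hκ i
  have hmono : ∑ i, ‖s.ξh xs i‖ ^ 2 ≤ ∑ i, u i * inner ℝ (s.ξh xs i) (ownGradient P.f i s.xh) :=
    hs.sum_norm_sub_sq_le s.xh
  simp only [Finset.sum_add_distrib, ← Finset.mul_sum] at hsum
  linarith

theorem sum_two_mul_inner_yDot_sub_le (hs : IsDiagonallyStableAt P.f xs u L)
    (hW : WeightBounds P.A P.K.θbar u m U) (hR : s.ConfinedTo xs R) (hκ : ∀ i, 0 ≤ P.κ i)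
    (hθ : 0 ≤ P.K.θ) {μ δ : ℝ} (hδ : 0 < δ) (hμ : ∀ (j : Fin N) (v : Profile N),
      μ * ∑ i, ‖v i‖ ^ 2 ≤ ∑ i, inner ℝ (v i) (P.A.groundedLaplacian j v i)) :
    ∑ i, ∑ j, 2 * (P.K.θbar i j)⁻¹ * inner ℝ (s.ηh i j) (P.yDot s i j - P.xhDot s j) ≤
      (-2 * P.K.θ * μ + N * L + U ^ 2 / δ + U ^ 2) * (∑ i, ∑ j, ‖s.ηh i j‖ ^ 2) +
        δ * (N ^ 2 * L) * (∑ i, ‖s.ξh xs i‖ ^ 2) +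
        2 * N * U * R * ∑ j, (P.K.θ + P.κ j) * ‖s.ζ₁ j‖ := by
  have hsum := Finset.sum_le_sum fun i (_ : i ∈ Finset.univ) =>
    Finset.sum_le_sum fun j (_ : j ∈ Finset.univ) =>
      two_mul_inner_yDot_sub_le hs hW hR hκ hθ hδ i j
  have hcoer : μ * ∑ i, ∑ j, ‖s.ηh i j‖ ^ 2 ≤
      ∑ i, ∑ j, inner ℝ (s.ηh i j) (P.A.groundedLaplacian j (fun k => s.ηh k j) i) := by
    rw [Finset.sum_comm, Finset.mul_sum, Finset.sum_comm (γ := Fin N)]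
    exact Finset.sum_le_sum fun j _ => hμ j fun i => s.ηh i j
  simp only [Finset.sum_add_distrib, ← Finset.mul_sum, Finset.sum_const, Finset.card_univ,
    Fintype.card_fin, nsmul_eq_mul] at hsum
  have hcoer' := mul_le_mul_of_nonneg_left hcoer (by positivity : 0 ≤ 2 * P.K.θ)
  linarith

/-- The value of `θ` beyond which the formation energy is dissipated: `μ` is the coercivity
constant of the grounded Laplacians, `L` and `U` bound the pseudo-gradient and the weights. -/
noncomputable def thetaThreshold (N : ℕ) (L U μ : ℝ) : ℝ :=
  (1 + 2 * U ^ 2 * L + N * L + 2 * U ^ 2 * (N ^ 2 * L + 1) + U ^ 2) / (2 * μ)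

theorem thetaThreshold_pos (hL : 0 ≤ L) {μ : ℝ} (hμ : 0 < μ) : 0 < thetaThreshold N L U μ := by
  unfold thetaThreshold
  positivity

theorem formationRate_le (hs : IsDiagonallyStableAt P.f xs u L)
    (hW : WeightBounds P.A P.K.θbar u m U) (hR : s.ConfinedTo xs R) (hU : 0 ≤ U) (hR₀ : 0 ≤ R)
    (hκ : ∀ i, 0 ≤ P.κ i) {μ : ℝ} (hμ : 0 < μ) (hA : ∀ (j : Fin N) (v : Profile N),
      μ * ∑ i, ‖v i‖ ^ 2 ≤ ∑ i, inner ℝ (v i) (P.A.groundedLaplacian j v i))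
    (hθ : thetaThreshold N L U μ < P.K.θ) :
    P.formationRate u xs s ≤
      -s.formationNormSq xs + R * ((2 + 2 * N) * U) * ∑ j, (P.K.θ + P.κ j) * ‖s.ζ₁ j‖ := by
  have hL := hs.lipschitz_nonneg
  have hθ₀ : 0 < P.K.θ := (thetaThreshold_pos hL hμ).trans hθ
  have hδL : 1 / (2 * (N ^ 2 * L + 1)) * (N ^ 2 * L) ≤ 1 / 2 := by
    rw [div_mul_eq_mul_div, div_le_div_iff₀ (by positivity) two_pos]
    linarith
  have hpos := sum_two_mul_inner_xhDot_le hs hW hR hκ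
  have hest := sum_two_mul_inner_yDot_sub_le hs hW hR hκ hθ₀.le
    (by positivity : 0 < 1 / (2 * (N ^ 2 * L + 1))) hA
  have hinj : ∑ j, P.κ j * ‖s.ζ₁ j‖ ≤ ∑ j, (P.K.θ + P.κ j) * ‖s.ζ₁ j‖ := by
    gcongr
    exact le_add_of_nonneg_left hθ₀.le
  have hinj' := mul_le_mul_of_nonneg_left hinj (by positivity : 0 ≤ 2 * U * R)
  have hξ := mul_le_mul_of_nonneg_right hδL
    (Finset.sum_nonneg fun i (_ : i ∈ Finset.univ) => sq_nonneg ‖s.ξh xs i‖)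
  have hη := mul_le_mul_of_nonneg_right ((div_lt_iff₀ (by positivity)).1 hθ).le
    (Finset.sum_nonneg fun i (_ : i ∈ Finset.univ) =>
      Finset.sum_nonneg fun j (_ : j ∈ Finset.univ) => sq_nonneg ‖s.ηh i j‖)
  rw [div_div_eq_mul_div, div_one] at hest
  unfold formationRate State.formationNormSq
  linarith

end Loop

section SignumSelection

/-- The `ℓ¹` norm on the plane: a signum selection `σ` of `e` satisfies `⟪σ, e⟫ = l1 e`. -/
noncomputable def l1 (x : Plane) : ℝ := ∑ k, |x k|

theorem norm_le_l1 (x : Plane) : ‖x‖ ≤ l1 x := by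
  rw [EuclideanSpace.norm_eq]
  refine (Real.sqrt_le_left (Finset.sum_nonneg fun k _ => abs_nonneg (x k))).2 ?_
  exact Finset.sum_sq_le_sq_sum_of_nonneg fun k _ => norm_nonneg (x k)

theorem l1_le (x : Plane) : l1 x ≤ 2 * ‖x‖ := by
  calc l1 x ≤ ∑ _k : Fin 2, ‖x‖ := Finset.sum_le_sum fun k _ => PiLp.norm_apply_le x k
    _ = 2 * ‖x‖ := by simp

theorem mul_eq_abs_of_mem_SGN {r v : ℝ} (h : v ∈ SGN r) : v * r = |r| := by
  rcases lt_trichotomy r 0 with hneg | rfl | hpos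
  · rw [h.2 hneg.ne, Real.sign_of_neg hneg, abs_of_neg hneg, neg_one_mul]
  · rw [mul_zero, abs_zero]
  · rw [h.2 hpos.ne', Real.sign_of_pos hpos, abs_of_pos hpos, one_mul]

theorem inner_eq_l1_of_mem_SGN {e σ : Plane} (h : ∀ k, σ k ∈ SGN (e k)) : inner ℝ σ e = l1 e := by
  rw [PiLp.inner_apply, l1]
  refine Finset.sum_congr rfl fun k _ => ?_
  rw [← mul_eq_abs_of_mem_SGN (h k), RCLike.inner_apply', conj_trivial]

theorem norm_le_two_of_mem_SGN {e σ : Plane} (h : ∀ k, σ k ∈ SGN (e k)) : ‖σ‖ ≤ 2 := by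
  calc ‖σ‖ ≤ l1 σ := norm_le_l1 σ
    _ ≤ ∑ _k : Fin 2, 1 := Finset.sum_le_sum fun k _ => abs_le.2 (h k).1
    _ = 2 := by simp

theorem hasDerivAt_abs_of_mem_SGN {f : ℝ → ℝ} {f' v t : ℝ} (hf : HasDerivAt f f' t)
    (habs : DifferentiableAt ℝ (fun s => |f s|) t) (hv : v ∈ SGN (f t)) :
    HasDerivAt (fun s => |f s|) (v * f') t := by
  by_cases h₀ : f t = 0
  · have hmin : IsLocalMin (fun s => |f s|) t :=
      Eventually.of_forall fun s => by simp only [h₀, abs_zero, abs_nonneg]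
    have habs₀ : HasDerivAt (fun s => |f s|) 0 t := hmin.deriv_eq_zero ▸ habs.hasDerivAt
    have hf₀ : HasDerivAt f 0 t := by
      rw [hasDerivAt_iff_isLittleO] at habs₀ ⊢
      simp only [h₀, abs_zero, sub_zero, smul_zero] at habs₀ ⊢
      exact Asymptotics.isLittleO_norm_left.1 habs₀
    rwa [hf.unique hf₀, mul_zero]
  · rw [hv.2 h₀]
    rcases lt_or_gt_of_ne h₀ with hneg | hpos
    · rw [Real.sign_of_neg hneg]
      exact (hasDerivAt_abs_neg hneg).comp t hf
    · rw [Real.sign_of_pos hpos]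
      exact (hasDerivAt_abs_pos hpos).comp t hf

theorem hasDerivAt_l1_of_mem_SGN {e : ℝ → Plane} {e' σ : Plane} {t : ℝ} (he : HasDerivAt e e' t)
    (habs : ∀ k, DifferentiableAt ℝ (fun s => |e s k|) t) (hσ : ∀ k, σ k ∈ SGN (e t k)) :
    HasDerivAt (fun s => l1 (e s)) (inner ℝ σ e') t := by
  have hcoord (k : Fin 2) : HasDerivAt (fun s => e s k) (e' k) t :=
    (EuclideanSpace.proj (𝕜 := ℝ) k).hasFDerivAt.comp_hasDerivAt t he
  simp only [PiLp.inner_apply, RCLike.inner_apply', conj_trivial]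
  exact HasDerivAt.fun_sum fun k _ => hasDerivAt_abs_of_mem_SGN (hcoord k) (habs k) (hσ k)

theorem absolutelyContinuous_apply {f : ℝ → Plane} {a b : ℝ}
    (hf : AbsolutelyContinuousOnInterval f a b) (k : Fin 2) :
    AbsolutelyContinuousOnInterval (fun t => f t k) a b :=
  absolutelyContinuous_comp (EuclideanSpace.proj (𝕜 := ℝ) k).lipschitz.locallyLipschitz hf

end SignumSelection

section Observer

/-- The energy of an observer with error `e`, shifted extended-state error `ψ` and signum gain `β`,
under a disturbance with derivative `v`. The term in `v` keeps `v` itself, which does not tend to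
zero, out of the derivative of the energy. -/
noncomputable def observerEnergy (β : ℝ) (e ψ v : Plane) : ℝ :=
  1 / (2 * β) * ‖ψ‖ ^ 2 + (l1 e - 1 / β * inner ℝ e v)

/-- The derivative of `observerEnergy` when `e`, `ψ`, `v` have the derivatives `e'`, `ψ'`, `v'` and
`σ` is a signum selection of `e`. -/
noncomputable def observerRate (β : ℝ) (σ e ψ v e' ψ' v' : Plane) : ℝ :=
  1 / β * inner ℝ ψ ψ' + (inner ℝ σ e' - 1 / β * (inner ℝ e' v + inner ℝ e v'))

theorem abs_inner_div_le {x y : Plane} {β : ℝ} (hβ : 0 < β) (hy : 4 * ‖y‖ ≤ β) :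
    |1 / β * inner ℝ x y| ≤ 1 / 4 * ‖x‖ := by
  rw [abs_mul, abs_of_pos (one_div_pos.2 hβ), one_div_mul_eq_div, div_le_iff₀ hβ]
  calc |inner ℝ x y| ≤ ‖x‖ * ‖y‖ := abs_real_inner_le_norm x y
    _ ≤ ‖x‖ * (β / 4) := by gcongr; linarith
    _ = 1 / 4 * ‖x‖ * β := by ring

variable {β : ℝ} {e ψ v : Plane}

theorem le_observerEnergy (hβ : 0 < β) (hv : 4 * ‖v‖ ≤ β) :
    1 / (2 * β) * ‖ψ‖ ^ 2 + 1 / 2 * ‖e‖ ≤ observerEnergy β e ψ v := by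
  have hinner := le_of_abs_le (abs_inner_div_le (x := e) hβ hv)
  have hl1 := norm_le_l1 e
  unfold observerEnergy
  linarith [norm_nonneg e]

theorem observerEnergy_le (hβ : 0 < β) (hv : 4 * ‖v‖ ≤ β) :
    observerEnergy β e ψ v ≤ 1 / (2 * β) * ‖ψ‖ ^ 2 + 3 * ‖e‖ := by
  have hinner := neg_le_of_abs_le (abs_inner_div_le (x := e) hβ hv)
  have hl1 := l1_le e
  unfold observerEnergy
  linarith [norm_nonneg e]

theorem observerRate_eq {ks c : ℝ} (hβ : β ≠ 0) (σ Δ w v' : Plane) :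
    observerRate β σ e ψ v (ψ + Δ - c • e) (w + v - ks • (ψ + Δ) - β • σ) v' =
      1 / β * (inner ℝ ψ (w - ks • Δ) - ks * ‖ψ‖ ^ 2) + inner ℝ σ Δ - 1 / β * inner ℝ Δ v -
        c * (inner ℝ σ e - 1 / β * inner ℝ e v) - 1 / β * inner ℝ e v' := by
  simp only [observerRate, inner_sub_right, inner_add_right, inner_smul_right, inner_sub_left,
    inner_add_left, real_inner_smul_left, real_inner_self_eq_norm_sq, real_inner_comm ψ σ]
  field_simp
  ring

theorem observerRate_le {ks c : ℝ} {σ Δ w v' : Plane} (hβ : 0 < β) (hks : 1 ≤ ks) (hc : 1 ≤ c)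
    (hσ : ∀ k, σ k ∈ SGN (e k)) (hv : 4 * ‖v‖ ≤ β) (hv' : 4 * ‖v'‖ ≤ β) :
    observerRate β σ e ψ v (ψ + Δ - c • e) (w + v - ks • (ψ + Δ) - β • σ) v' ≤
      -(1 / (2 * β) * ‖ψ‖ ^ 2) + 1 / (2 * β) * ‖w - ks • Δ‖ ^ 2 + 3 * ‖Δ‖ - c / 2 * ‖e‖ := by
  have hψ : 1 / β * (inner ℝ ψ (w - ks • Δ) - ks * ‖ψ‖ ^ 2) ≤
      1 / (2 * β) * (‖w - ks • Δ‖ ^ 2 - ‖ψ‖ ^ 2) := by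
    have hcs := real_inner_le_norm ψ (w - ks • Δ)
    have hks' := le_mul_of_one_le_left (sq_nonneg ‖ψ‖) hks
    rw [← div_div, div_eq_mul_one_div (1 / 2) β, mul_comm (1 / 2), mul_assoc]
    gcongr
    linarith [sq_nonneg (‖ψ‖ - ‖w - ks • Δ‖)]
  have hσΔ : inner ℝ σ Δ ≤ 2 * ‖Δ‖ := (real_inner_le_norm σ Δ).trans
    (mul_le_mul_of_nonneg_right (norm_le_two_of_mem_SGN hσ) (norm_nonneg Δ))
  have hΔv := neg_le_of_abs_le (abs_inner_div_le (x := Δ) hβ hv)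
  have hev := le_of_abs_le (abs_inner_div_le (x := e) hβ hv)
  have hev' := neg_le_of_abs_le (abs_inner_div_le (x := e) hβ hv')
  have hσe : ‖e‖ ≤ inner ℝ σ e := (norm_le_l1 e).trans_eq (inner_eq_l1_of_mem_SGN hσ).symm
  have hdecay : c * (3 / 4 * ‖e‖) ≤ c * (inner ℝ σ e - 1 / β * inner ℝ e v) := by
    gcongr
    linarith
  have hce := le_mul_of_one_le_left (norm_nonneg e) hc
  rw [observerRate_eq hβ.ne']
  linarith [norm_nonneg Δ]

theorem hasDerivAt_observerEnergy {e ψ v : ℝ → Plane} {e' ψ' v' σ : Plane} {t : ℝ}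
    (he : HasDerivAt e e' t) (hψ : HasDerivAt ψ ψ' t) (hv : HasDerivAt v v' t)
    (habs : ∀ k, DifferentiableAt ℝ (fun s => |e s k|) t) (hσ : ∀ k, σ k ∈ SGN (e t k)) :
    HasDerivAt (fun s => observerEnergy β (e s) (ψ s) (v s))
      (observerRate β σ (e t) (ψ t) (v t) e' ψ' v') t := by
  have hsgn := (hasDerivAt_l1_of_mem_SGN he habs hσ).fun_sub ((he.inner ℝ hv).const_mul (1 / β))
  refine ((hψ.norm_sq.const_mul (1 / (2 * β))).fun_add hsgn).congr_deriv ?_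
  unfold observerRate
  ring

theorem absolutelyContinuous_observerEnergy {e ψ v : ℝ → Plane} {a b : ℝ}
    (he : AbsolutelyContinuousOnInterval e a b) (hψ : AbsolutelyContinuousOnInterval ψ a b)
    (hv : AbsolutelyContinuousOnInterval v a b) :
    AbsolutelyContinuousOnInterval (fun t => observerEnergy β (e t) (ψ t) (v t)) a b :=
  .fun_add (.const_mul _ (absolutelyContinuous_norm_sq hψ)) <|
    .fun_sub (absolutelyContinuous_sum fun k =>
      absolutelyContinuous_abs (absolutelyContinuous_apply he k))
      (.const_mul _ (absolutelyContinuous_inner he hv))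

end Observer

/-- `ℓ` bounds the derivatives of the unmodelled terms `g` in the ball of radius `ρ` about `xs`. -/
structure HasBoundedFDeriv (g : Fin N → Profile N → Plane) (xs : Profile N) (ρ ℓ : ℝ) : Prop where
  nonneg : 0 ≤ ℓ
  differentiable : ∀ i, Differentiable ℝ (g i)
  norm_fderiv_le : ∀ i, ∀ x ∈ Metric.closedBall xs ρ, ‖fderiv ℝ (g i) x‖ ≤ ℓ

theorem HasBoundedFDeriv.norm_sub_le {g : Fin N → Profile N → Plane} {xs : Profile N} {ρ ℓ : ℝ}
    (hg : HasBoundedFDeriv g xs ρ ℓ) (i : Fin N) {x y : Profile N}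
    (hx : x ∈ Metric.closedBall xs ρ) (hy : y ∈ Metric.closedBall xs ρ) :
    ‖g i y - g i x‖ ≤ ℓ * ‖y - x‖ :=
  (convex_closedBall xs ρ).norm_image_sub_le_of_norm_fderiv_le (fun z _ => hg.differentiable i z)
    (hg.norm_fderiv_le i) hx hy

theorem exists_hasBoundedFDeriv {g : Fin N → Profile N → Plane} (hg : ∀ i, ContDiff ℝ 1 (g i))
    (xs : Profile N) (ρ : ℝ) : ∃ ℓ, HasBoundedFDeriv g xs ρ ℓ := by
  choose C hC using fun i => (isCompact_closedBall xs ρ).exists_bound_of_continuousOn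
    ((hg i).continuous_fderiv one_ne_zero).continuousOn
  obtain ⟨ℓ, hℓ⟩ := Finite.exists_le C
  exact ⟨max ℓ 0, le_max_right ℓ 0, fun i => (hg i).differentiable one_ne_zero,
    fun i x hx => (hC i x hx).trans ((hℓ i).trans (le_max_left ℓ 0))⟩

theorem pi_norm_le_sum {ι E : Type*} [Fintype ι] [SeminormedAddCommGroup E] (v : ι → E) :
    ‖v‖ ≤ ∑ i, ‖v i‖ :=
  (pi_norm_le_iff_of_nonneg (Finset.sum_nonneg fun i _ => norm_nonneg (v i))).2 fun i =>
    Finset.single_le_sum (f := fun i => ‖v i‖) (fun i _ => norm_nonneg (v i)) (Finset.mem_univ i)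

theorem State.ConfinedTo.xh_mem {s : State N} {xs : Profile N} {R : ℝ} (h : s.ConfinedTo xs R)
    (hR : 0 ≤ R) : s.xh ∈ Metric.closedBall xs (2 * R) := by
  rw [mem_closedBall_iff_norm, pi_norm_le_iff_of_nonneg (by positivity)]
  exact fun i => (h.ξh_le i).trans (by linarith)

theorem State.ConfinedTo.x_mem {s : State N} {xs : Profile N} {R : ℝ} (h : s.ConfinedTo xs R)
    (hR : 0 ≤ R) : s.x ∈ Metric.closedBall xs (2 * R) := by
  rw [mem_closedBall_iff_norm, pi_norm_le_iff_of_nonneg (by positivity)]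
  intro i
  calc ‖s.x i - xs i‖ = ‖s.ξh xs i + s.ζ₁ i‖ := by rw [s.ξh_add_ζ₁, ξ]
    _ ≤ ‖s.ξh xs i‖ + ‖s.ζ₁ i‖ := norm_add_le _ _
    _ ≤ 2 * R := by linarith [h.ζ₁_le i, h.ξh_le i]

theorem State.formationNormSq_nonneg (s : State N) (xs : Profile N) : 0 ≤ s.formationNormSq xs :=
  add_nonneg (Finset.sum_nonneg fun _ _ => sq_nonneg _)
    (Finset.sum_nonneg fun _ _ => Finset.sum_nonneg fun _ _ => sq_nonneg _)

theorem State.ConfinedTo.sum_norm_sq_le {s : State N} {xs : Profile N} {R : ℝ}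
    (h : s.ConfinedTo xs R) :
    (∑ j, ‖s.ζ₁ j‖) ^ 2 ≤ N * R * ∑ j, ‖s.ζ₁ j‖ := by
  rw [sq]
  refine mul_le_mul_of_nonneg_right ?_ (Finset.sum_nonneg fun _ _ => norm_nonneg _)
  calc ∑ j, ‖s.ζ₁ j‖ ≤ ∑ _j : Fin N, R := Finset.sum_le_sum fun j _ => h.ζ₁_le j
    _ = N * R := by simp

theorem State.norm_ξh_sq_le (s : State N) (xs : Profile N) (i : Fin N) :
    ‖s.ξh xs i‖ ^ 2 ≤ s.formationNormSq xs :=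
  le_add_of_le_of_nonneg (norm_sq_le_sum (s.ξh xs) i)
    (Finset.sum_nonneg fun _ _ => Finset.sum_nonneg fun _ _ => sq_nonneg _)

theorem State.sum_norm_ηh_sq_le (s : State N) (i : Fin N) :
    ∑ j, ‖s.ηh i j‖ ^ 2 ≤ ∑ i, ∑ j, ‖s.ηh i j‖ ^ 2 :=
  Finset.single_le_sum (f := fun i => ∑ j, ‖s.ηh i j‖ ^ 2)
    (fun _ _ => Finset.sum_nonneg fun _ _ => sq_nonneg _) (Finset.mem_univ i)

theorem State.norm_ηh_sq_le (s : State N) (xs : Profile N) (i j : Fin N) :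
    ‖s.ηh i j‖ ^ 2 ≤ s.formationNormSq xs :=
  le_add_of_nonneg_of_le (Finset.sum_nonneg fun _ _ => sq_nonneg _)
    ((norm_sq_le_sum (s.ηh i) j).trans (s.sum_norm_ηh_sq_le i))

/-- The constants of the stability analysis: `L` for the pseudo-gradient, `m` and `U` for the
weights, `μ` for the grounded Laplacians, the radius `R` of confinement, `ℓ` for the derivatives of
the unmodelled terms, `K` for the observer gains and `D` for the derivatives of the disturbances. -/
structure StabilityConstants where
  (L m U μ R ℓ K D : ℝ)

namespace StabilityConstants

variable (k : StabilityConstants) (N : ℕ)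

/-- The weight of the observer energies in the Lyapunov function, chosen such that their decay
absorbs the injection terms in the derivative of the formation energy. -/
noncomputable def lam : ℝ := 16 * (k.R * ((2 + 2 * N) * k.U))

/-- The constant `M` for which `M * (W + E)` bounds the squared drift of the shifted observer errors
at confined states, with `W` the squared formation error and `E` the sum of the `‖ζ₁ i‖`. -/
noncomputable def drift : ℝ := 8 * k.ℓ ^ 2 * k.L + (4 + 2 * N) * k.K ^ 2 * k.ℓ ^ 2 * k.R

/-- The exponential rate of decay of the Lyapunov function. -/
noncomputable def rate : ℝ := 1 / (12 + 2 * k.U)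

end StabilityConstants

namespace Loop

/-- The gains of the loop dominate the constants `k`, which are valid for the loop. -/
structure IsTuned (P : Loop N) (xs : Profile N) (u : Fin N → ℝ) (k : StabilityConstants) :
    Prop where
  stable : IsDiagonallyStableAt P.f xs u k.L
  weights : WeightBounds P.A P.K.θbar u k.m k.U
  U_nonneg : 0 ≤ k.U
  μ_pos : 0 < k.μ
  coercive : ∀ (j : Fin N) (v : Profile N),
    k.μ * ∑ i, ‖v i‖ ^ 2 ≤ ∑ i, inner ℝ (v i) (P.A.groundedLaplacian j v i)
  R_pos : 0 < k.R
  bounded : HasBoundedFDeriv P.g xs (2 * k.R) k.ℓ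
  lt_θ : thetaThreshold N k.L k.U k.μ < P.K.θ
  one_le_ks : ∀ i, 1 ≤ P.K.ks i
  one_le_c : ∀ i, 1 ≤ P.K.c i
  θ_add_ks_le_c : ∀ i, P.K.θ + P.K.ks i ≤ P.K.c i
  le_c : ∀ i, 8 * (N * (1 + 3 * k.ℓ)) ≤ P.K.c i
  κ_le : ∀ i, P.κ i ≤ k.K
  β_pos : ∀ i, 0 < P.K.β i
  four_mul_le_β : ∀ i, 4 * k.D ≤ P.K.β i
  drift_le_β : ∀ i, (2 * k.lam N * N + 1) * k.drift N ≤ P.K.β i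

/-- The observer error of the extended state, with the unmodelled term taken at the observed
positions and shifted by `-k_i^s ζ_i1`. -/
noncomputable def ψ (P : Loop N) (t : ℝ) (s : State N) (i : Fin N) : Plane :=
  P.g i s.xh + P.d i t - s.zh i - P.K.ks i • s.ζ₁ i

/-- The error made by evaluating the unmodelled term at the observed positions. -/
noncomputable def mismatch (P : Loop N) (s : State N) (i : Fin N) : Plane := P.g i s.x - P.g i s.xh

/-- The drift of `ψ_i` due to the motion of the observed positions and the mismatch. -/
noncomputable def drift (P : Loop N) (s : State N) (i : Fin N) : Plane :=
  fderiv ℝ (P.g i) s.xh (P.xhDot s) - P.K.ks i • P.mismatch s i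

section Estimates

variable {P : Loop N} {s : State N} {xs : Profile N} {u : Fin N → ℝ} {k : StabilityConstants}

theorem IsTuned.lam_nonneg (hT : P.IsTuned xs u k) : 0 ≤ k.lam N := by
  have := hT.U_nonneg
  have := hT.R_pos
  unfold StabilityConstants.lam
  positivity

theorem IsTuned.ks_nonneg (hT : P.IsTuned xs u k) (i : Fin N) : 0 ≤ P.K.ks i :=
  zero_le_one.trans (hT.one_le_ks i)

theorem IsTuned.ks_le (hT : P.IsTuned xs u k) (i : Fin N) : P.K.ks i ≤ k.K :=
  (le_add_of_nonneg_right (zero_le_one.trans (hT.one_le_c i))).trans (hT.κ_le i)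

theorem IsTuned.κ_nonneg (hT : P.IsTuned xs u k) (i : Fin N) : 0 ≤ P.κ i :=
  add_nonneg (hT.ks_nonneg i) (zero_le_one.trans (hT.one_le_c i))

theorem IsTuned.norm_mismatch_le (hT : P.IsTuned xs u k) (hR : s.ConfinedTo xs k.R) (i : Fin N) :
    ‖P.mismatch s i‖ ≤ k.ℓ * ∑ j, ‖s.ζ₁ j‖ := by
  have hR₀ := hT.R_pos.le
  calc ‖P.mismatch s i‖ ≤ k.ℓ * ‖s.x - s.xh‖ :=
        hT.bounded.norm_sub_le i (hR.xh_mem hR₀) (hR.x_mem hR₀)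
    _ ≤ k.ℓ * ∑ j, ‖s.ζ₁ j‖ :=
        mul_le_mul_of_nonneg_left (pi_norm_le_sum (s.x - s.xh)) hT.bounded.nonneg

theorem norm_ownGradient_estimate_sq_le {L : ℝ} (hs : IsDiagonallyStableAt P.f xs u L)
    (s : State N) (i : Fin N) :
    ‖ownGradient P.f i (s.y i)‖ ^ 2 ≤ 2 * L * s.formationNormSq xs := by
  have hL := hs.lipschitz_nonneg
  have hlip := hs.norm_sub_sq_le i (s.y i) xs
  rw [hs.ownGradient_eq_zero, sub_zero] at hlip
  have hrow := s.sum_norm_ηh_sq_le i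
  have hsplit (j : Fin N) : ‖s.y i j - xs j‖ ^ 2 ≤ 2 * (‖s.ηh i j‖ ^ 2 + ‖s.ξh xs j‖ ^ 2) := by
    rw [← sub_add_sub_cancel (s.y i j) (s.xh j) (xs j)]
    exact (pow_le_pow_left₀ (norm_nonneg _) (norm_add_le _ _) 2).trans add_sq_le
  calc ‖ownGradient P.f i (s.y i)‖ ^ 2 ≤ L * ∑ j, ‖s.y i j - xs j‖ ^ 2 := hlip
    _ ≤ L * ∑ j, 2 * (‖s.ηh i j‖ ^ 2 + ‖s.ξh xs j‖ ^ 2) := by gcongr with j; exact hsplit j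
    _ = 2 * L * (∑ j, ‖s.ξh xs j‖ ^ 2 + ∑ j, ‖s.ηh i j‖ ^ 2) := by
      rw [← Finset.mul_sum, Finset.sum_add_distrib]; ring
    _ ≤ 2 * L * s.formationNormSq xs := by unfold State.formationNormSq; gcongr

theorem IsTuned.norm_xhDot_sq_le (hT : P.IsTuned xs u k) (hR : s.ConfinedTo xs k.R) (i : Fin N) :
    ‖P.xhDot s i‖ ^ 2 ≤
      4 * k.L * s.formationNormSq xs + 2 * k.K ^ 2 * k.R * ∑ j, ‖s.ζ₁ j‖ := by
  have hκ := hT.κ_nonneg i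
  have hR₀ := hT.R_pos.le
  have hζ : ‖s.ζ₁ i‖ ^ 2 ≤ k.R * ∑ j, ‖s.ζ₁ j‖ := by
    rw [sq]
    exact mul_le_mul (hR.ζ₁_le i) (Finset.single_le_sum (f := fun j => ‖s.ζ₁ j‖)
      (fun j _ => norm_nonneg _) (Finset.mem_univ i)) (norm_nonneg _) hR₀
  calc ‖P.xhDot s i‖ ^ 2 ≤ (‖ownGradient P.f i (s.y i)‖ + P.κ i * ‖s.ζ₁ i‖) ^ 2 := by
        rw [xhDot_eq]
        gcongr
        refine (norm_add_le _ _).trans_eq ?_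
        rw [norm_neg, norm_smul, Real.norm_of_nonneg hκ]
    _ ≤ 2 * (‖ownGradient P.f i (s.y i)‖ ^ 2 + (P.κ i * ‖s.ζ₁ i‖) ^ 2) := add_sq_le
    _ ≤ 2 * (2 * k.L * s.formationNormSq xs + k.K ^ 2 * (k.R * ∑ j, ‖s.ζ₁ j‖)) := by
        rw [mul_pow]
        gcongr
        exacts [norm_ownGradient_estimate_sq_le hT.stable s i, hT.κ_le i]
    _ = 4 * k.L * s.formationNormSq xs + 2 * k.K ^ 2 * k.R * ∑ j, ‖s.ζ₁ j‖ := by ring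

theorem IsTuned.norm_drift_sq_le (hT : P.IsTuned xs u k) (hR : s.ConfinedTo xs k.R) (i : Fin N) :
    ‖P.drift s i‖ ^ 2 ≤ k.drift N * (s.formationNormSq xs + ∑ j, ‖s.ζ₁ j‖) := by
  set W := s.formationNormSq xs
  set E := ∑ j, ‖s.ζ₁ j‖
  have hW : 0 ≤ W := s.formationNormSq_nonneg xs
  have : 0 ≤ E := Finset.sum_nonneg fun j _ => norm_nonneg _
  have hL := hT.stable.lipschitz_nonneg
  have := hT.bounded.nonneg
  have hR₀ := hT.R_pos.le
  have hks := hT.ks_nonneg i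
  have hksK := hT.ks_le i
  have hxh : ‖P.xhDot s‖ ^ 2 ≤ 4 * k.L * W + 2 * k.K ^ 2 * k.R * E :=
    pi_norm_sq_le (by positivity) (hT.norm_xhDot_sq_le hR)
  have hE2 : E ^ 2 ≤ N * k.R * E := hR.sum_norm_sq_le
  have hderiv : ‖fderiv ℝ (P.g i) s.xh (P.xhDot s)‖ ≤ k.ℓ * ‖P.xhDot s‖ :=
    (fderiv ℝ (P.g i) s.xh).le_of_opNorm_le (hT.bounded.norm_fderiv_le i _ (hR.xh_mem hR₀)) _
  have hmis : ‖P.K.ks i • P.mismatch s i‖ ≤ k.K * (k.ℓ * E) := by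
    rw [norm_smul, Real.norm_of_nonneg hks]
    exact mul_le_mul hksK (hT.norm_mismatch_le hR i) (norm_nonneg _) (hks.trans hksK)
  calc ‖P.drift s i‖ ^ 2 ≤ (k.ℓ * ‖P.xhDot s‖ + k.K * (k.ℓ * E)) ^ 2 := by
        gcongr
        exact (norm_sub_le _ _).trans (add_le_add hderiv hmis)
    _ ≤ 2 * ((k.ℓ * ‖P.xhDot s‖) ^ 2 + (k.K * (k.ℓ * E)) ^ 2) := add_sq_le
    _ = 2 * k.ℓ ^ 2 * ‖P.xhDot s‖ ^ 2 + 2 * k.K ^ 2 * k.ℓ ^ 2 * E ^ 2 := by ring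
    _ ≤ 2 * k.ℓ ^ 2 * (4 * k.L * W + 2 * k.K ^ 2 * k.R * E) +
          2 * k.K ^ 2 * k.ℓ ^ 2 * (N * k.R * E) := by gcongr
    _ ≤ k.drift N * (W + E) := by
        have hslack : 0 ≤ 8 * k.ℓ ^ 2 * k.L * E + (4 + 2 * N) * k.K ^ 2 * k.ℓ ^ 2 * k.R * W := by
          positivity
        unfold StabilityConstants.drift
        linarith

end Estimates

/-- The right-hand side for `ζ_i1` in the coordinates `ψ`. -/
noncomputable def ζ₁Dot (P : Loop N) (t : ℝ) (s : State N) (i : Fin N) : Plane :=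
  P.ψ t s i + P.mismatch s i - P.K.c i • s.ζ₁ i

/-- The right-hand side for `ψ_i`, for the signum selections `σ` and the derivatives `v` of the
disturbances. -/
noncomputable def ψDot (P : Loop N) (σ v : Profile N) (t : ℝ) (s : State N) (i : Fin N) : Plane :=
  fderiv ℝ (P.g i) s.xh (P.xhDot s) + v i - P.K.ks i • (P.ψ t s i + P.mismatch s i) - P.K.β i • σ i

/-- The formation energy `∑ u_i ‖ξ̂_i‖² + ∑ ‖η̂_ij‖² / θbar_ij`. -/
noncomputable def formationEnergy (P : Loop N) (u : Fin N → ℝ) (xs : Profile N) (s : State N) : ℝ :=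
  ∑ i, u i * ‖s.ξh xs i‖ ^ 2 + ∑ i, ∑ j, (P.K.θbar i j)⁻¹ * ‖s.ηh i j‖ ^ 2

/-- The Lyapunov function: the formation energy and the observer energies with weight `lam`, where
`v` are the current derivatives of the disturbances. -/
noncomputable def lyapunov (P : Loop N) (u : Fin N → ℝ) (xs : Profile N) (lam : ℝ) (v : Profile N)
    (t : ℝ) (s : State N) : ℝ :=
  P.formationEnergy u xs s +
    lam * ∑ i, observerEnergy (P.K.β i) (s.ζ₁ i) (P.ψ t s i) (v i)

/-- The derivative of `lyapunov` along the closed loop, for the signum selections `σ` and the first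
two derivatives `v`, `v'` of the disturbances. -/
noncomputable def lyapunovRate (P : Loop N) (u : Fin N → ℝ) (xs : Profile N) (lam : ℝ)
    (σ v v' : Profile N) (t : ℝ) (s : State N) : ℝ :=
  P.formationRate u xs s + lam * ∑ i, observerRate (P.K.β i) (σ i) (s.ζ₁ i) (P.ψ t s i) (v i)
    (P.ζ₁Dot t s i) (P.ψDot σ v t s i) (v' i)

section Lyapunov

variable {P : Loop N} {s : State N} {t : ℝ} {xs : Profile N} {u : Fin N → ℝ}
  {k : StabilityConstants} {m U : ℝ} {σ v v' : Profile N}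

theorem le_formationEnergy (hW : WeightBounds P.A P.K.θbar u m U) :
    m * s.formationNormSq xs ≤ P.formationEnergy u xs s := by
  simp only [State.formationNormSq, formationEnergy, mul_add, Finset.mul_sum]
  gcongr with i _ i _ j
  exacts [hW.le_weight i, hW.le_inv i j]

theorem formationEnergy_le (hW : WeightBounds P.A P.K.θbar u m U) :
    P.formationEnergy u xs s ≤ U * s.formationNormSq xs := by
  simp only [State.formationNormSq, formationEnergy, mul_add, Finset.mul_sum]
  gcongr with i _ i _ j
  exacts [hW.weight_le i, hW.inv_le i j]

theorem IsTuned.four_mul_norm_le_β (hT : P.IsTuned xs u k) (hv : ∀ i, ‖v i‖ ≤ k.D) (i : Fin N) :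
    4 * ‖v i‖ ≤ P.K.β i :=
  (mul_le_mul_of_nonneg_left (hv i) zero_le_four).trans (hT.four_mul_le_β i)

theorem IsTuned.le_lyapunov (hT : P.IsTuned xs u k) (hv : ∀ i, ‖v i‖ ≤ k.D) :
    k.m * s.formationNormSq xs +
        k.lam N * ∑ i, (1 / (2 * P.K.β i) * ‖P.ψ t s i‖ ^ 2 + 1 / 2 * ‖s.ζ₁ i‖) ≤
      P.lyapunov u xs (k.lam N) v t s :=
  add_le_add (le_formationEnergy hT.weights) <|
    mul_le_mul_of_nonneg_left (Finset.sum_le_sum fun i _ =>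
      le_observerEnergy (hT.β_pos i) (hT.four_mul_norm_le_β hv i)) hT.lam_nonneg

theorem IsTuned.lyapunov_le (hT : P.IsTuned xs u k) (hv : ∀ i, ‖v i‖ ≤ k.D) :
    P.lyapunov u xs (k.lam N) v t s ≤ k.U * s.formationNormSq xs +
      k.lam N * ∑ i, (1 / (2 * P.K.β i) * ‖P.ψ t s i‖ ^ 2 + 3 * ‖s.ζ₁ i‖) :=
  add_le_add (formationEnergy_le hT.weights) <|
    mul_le_mul_of_nonneg_left (Finset.sum_le_sum fun i _ =>
      observerEnergy_le (hT.β_pos i) (hT.four_mul_norm_le_β hv i)) hT.lam_nonneg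

theorem IsTuned.norm_drift_sq_div_le (hT : P.IsTuned xs u k) (hR : s.ConfinedTo xs k.R)
    (i : Fin N) : 1 / (2 * P.K.β i) * ‖P.drift s i‖ ^ 2 ≤
      1 / (2 * k.lam N * N + 1) * (s.formationNormSq xs + ∑ j, ‖s.ζ₁ j‖) := by
  have hβ := hT.β_pos i
  have hlam := hT.lam_nonneg
  have hWE : 0 ≤ s.formationNormSq xs + ∑ j, ‖s.ζ₁ j‖ :=
    add_nonneg (s.formationNormSq_nonneg xs) (Finset.sum_nonneg fun _ _ => norm_nonneg _)
  rw [one_div_mul_eq_div, one_div_mul_eq_div, div_le_div_iff₀ (by positivity) (by positivity)]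
  calc ‖P.drift s i‖ ^ 2 * (2 * k.lam N * N + 1)
      ≤ k.drift N * (s.formationNormSq xs + ∑ j, ‖s.ζ₁ j‖) * (2 * k.lam N * N + 1) := by
        gcongr
        exact hT.norm_drift_sq_le hR i
    _ = (2 * k.lam N * N + 1) * k.drift N * (s.formationNormSq xs + ∑ j, ‖s.ζ₁ j‖) := by ring
    _ ≤ P.K.β i * (s.formationNormSq xs + ∑ j, ‖s.ζ₁ j‖) := by
        gcongr
        exact hT.drift_le_β i
    _ ≤ (s.formationNormSq xs + ∑ j, ‖s.ζ₁ j‖) * (2 * P.K.β i) := by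
        linarith [mul_nonneg hWE hβ.le]

theorem IsTuned.observerRate_le (hT : P.IsTuned xs u k) (hR : s.ConfinedTo xs k.R)
    (hσ : ∀ i l, σ i l ∈ SGN (s.ζ₁ i l)) (hv : ∀ i, ‖v i‖ ≤ k.D) (hv' : ∀ i, ‖v' i‖ ≤ k.D)
    (i : Fin N) :
    observerRate (P.K.β i) (σ i) (s.ζ₁ i) (P.ψ t s i) (v i) (P.ζ₁Dot t s i) (P.ψDot σ v t s i)
        (v' i) ≤ -(1 / (2 * P.K.β i) * ‖P.ψ t s i‖ ^ 2) - 1 / 2 * (P.K.c i * ‖s.ζ₁ i‖) +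
      (1 / (2 * k.lam N * N + 1) * (s.formationNormSq xs + ∑ j, ‖s.ζ₁ j‖) +
        3 * k.ℓ * ∑ j, ‖s.ζ₁ j‖) := by
  have hrate := SensorSeeking.observerRate_le (ψ := P.ψ t s i) (Δ := P.mismatch s i)
    (w := fderiv ℝ (P.g i) s.xh (P.xhDot s)) (hT.β_pos i) (hT.one_le_ks i) (hT.one_le_c i) (hσ i)
    (hT.four_mul_norm_le_β hv i) (hT.four_mul_norm_le_β hv' i)
  have hdrift := hT.norm_drift_sq_div_le hR i
  have hmismatch := hT.norm_mismatch_le hR i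
  unfold ζ₁Dot ψDot
  unfold drift at hdrift
  linarith

theorem IsTuned.sum_gain_mul_norm_le (hT : P.IsTuned xs u k) :
    k.R * ((2 + 2 * N) * k.U) * ∑ j, (P.K.θ + P.κ j) * ‖s.ζ₁ j‖ ≤
      k.lam N * (1 / 8 * ∑ j, P.K.c j * ‖s.ζ₁ j‖) := by
  have hgain : ∑ j, (P.K.θ + P.κ j) * ‖s.ζ₁ j‖ ≤ ∑ j, 2 * (P.K.c j * ‖s.ζ₁ j‖) := by
    refine Finset.sum_le_sum fun j _ => ?_
    rw [← mul_assoc]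
    gcongr
    unfold κ
    linarith [hT.θ_add_ks_le_c j]
  have hlam := hT.lam_nonneg
  unfold StabilityConstants.lam at hlam ⊢
  rw [← Finset.mul_sum] at hgain
  linarith [mul_le_mul_of_nonneg_left hgain hlam]

theorem IsTuned.le_sum_c_mul_norm (hT : P.IsTuned xs u k) :
    8 * (N * (1 + 3 * k.ℓ)) * ∑ j, ‖s.ζ₁ j‖ ≤ ∑ j, P.K.c j * ‖s.ζ₁ j‖ := by
  rw [Finset.mul_sum]
  gcongr with j
  exact hT.le_c j

theorem IsTuned.mul_sum_observerRate_le (hT : P.IsTuned xs u k) (hR : s.ConfinedTo xs k.R)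
    (hσ : ∀ i l, σ i l ∈ SGN (s.ζ₁ i l)) (hv : ∀ i, ‖v i‖ ≤ k.D) (hv' : ∀ i, ‖v' i‖ ≤ k.D) :
    k.lam N * ∑ i, observerRate (P.K.β i) (σ i) (s.ζ₁ i) (P.ψ t s i) (v i) (P.ζ₁Dot t s i)
        (P.ψDot σ v t s i) (v' i) ≤
      1 / 2 * s.formationNormSq xs -
        k.lam N * ∑ i, (1 / (2 * P.K.β i) * ‖P.ψ t s i‖ ^ 2 + 3 / 8 * (P.K.c i * ‖s.ζ₁ i‖)) := by
  set W := s.formationNormSq xs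
  set E := ∑ j, ‖s.ζ₁ j‖
  set ε := 1 / (2 * k.lam N * N + 1)
  have hlam := hT.lam_nonneg
  have hε : ε ≤ 1 := div_le_one_of_le₀ (le_add_of_nonneg_left (by positivity)) (by positivity)
  have hεlam : k.lam N * N * ε ≤ 1 / 2 := by
    rw [mul_one_div, div_le_div_iff₀ (by positivity) two_pos]
    linarith
  have hsum := Finset.sum_le_sum fun i (_ : i ∈ Finset.univ) =>
    hT.observerRate_le (t := t) hR hσ hv hv' i
  simp only [Finset.sum_add_distrib, Finset.sum_sub_distrib, Finset.sum_neg_distrib,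
    ← Finset.mul_sum, Finset.sum_const, Finset.card_univ, Fintype.card_fin,
    nsmul_eq_mul] at hsum ⊢
  have hE : N * (ε * E) ≤ N * E :=
    mul_le_mul_of_nonneg_left (mul_le_of_le_one_left (by positivity) hε) N.cast_nonneg
  have hW : k.lam N * N * ε * W ≤ 1 / 2 * W :=
    mul_le_mul_of_nonneg_right hεlam (s.formationNormSq_nonneg xs)
  have hc : 8 * (N * (1 + 3 * k.ℓ)) * E ≤ ∑ j, P.K.c j * ‖s.ζ₁ j‖ := hT.le_sum_c_mul_norm
  have hmul := mul_le_mul_of_nonneg_left hsum hlam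
  have hmulE := mul_le_mul_of_nonneg_left hE hlam
  have hmulc := mul_le_mul_of_nonneg_left hc hlam
  linarith

theorem IsTuned.rate_mul_lyapunov_le (hT : P.IsTuned xs u k) (hv : ∀ i, ‖v i‖ ≤ k.D) :
    k.rate * P.lyapunov u xs (k.lam N) v t s ≤ 1 / 2 * s.formationNormSq xs +
      k.lam N * ∑ i, (1 / (2 * P.K.β i) * ‖P.ψ t s i‖ ^ 2 + 1 / 4 * ‖s.ζ₁ i‖) := by
  have hU := hT.U_nonneg
  have hlam := hT.lam_nonneg
  have hV := hT.lyapunov_le (t := t) (s := s) hv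
  have hW := s.formationNormSq_nonneg xs
  have hΨ : 0 ≤ ∑ i, 1 / (2 * P.K.β i) * ‖P.ψ t s i‖ ^ 2 := Finset.sum_nonneg fun i _ => by
    have := hT.β_pos i
    positivity
  have hE : 0 ≤ ∑ i, ‖s.ζ₁ i‖ := Finset.sum_nonneg fun _ _ => norm_nonneg _
  rw [StabilityConstants.rate, one_div_mul_eq_div, div_le_iff₀ (by positivity)]
  simp only [Finset.sum_add_distrib, ← Finset.mul_sum] at hV ⊢
  linarith [mul_nonneg hlam hΨ, mul_nonneg hU (mul_nonneg hlam hΨ),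
    mul_nonneg hU (mul_nonneg hlam hE)]

theorem IsTuned.lyapunovRate_le (hT : P.IsTuned xs u k) (hR : s.ConfinedTo xs k.R)
    (hσ : ∀ i l, σ i l ∈ SGN (s.ζ₁ i l)) (hv : ∀ i, ‖v i‖ ≤ k.D) (hv' : ∀ i, ‖v' i‖ ≤ k.D) :
    P.lyapunovRate u xs (k.lam N) σ v v' t s ≤
      -k.rate * P.lyapunov u xs (k.lam N) v t s := by
  have hform := formationRate_le hT.stable hT.weights hR hT.U_nonneg hT.R_pos.le hT.κ_nonneg
    hT.μ_pos hT.coercive hT.lt_θ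
  have hobs := hT.mul_sum_observerRate_le (t := t) hR hσ hv hv'
  have hinj := hT.sum_gain_mul_norm_le (s := s)
  have hζ : ∑ i, ‖s.ζ₁ i‖ ≤ ∑ i, P.K.c i * ‖s.ζ₁ i‖ := Finset.sum_le_sum fun i _ =>
    le_mul_of_one_le_left (norm_nonneg _) (hT.one_le_c i)
  have hV := hT.rate_mul_lyapunov_le (t := t) (s := s) hv
  simp only [Finset.sum_add_distrib, ← Finset.mul_sum] at hobs hV
  unfold lyapunovRate
  linarith [mul_le_mul_of_nonneg_left hζ hT.lam_nonneg]

end Lyapunov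

end Loop

/-- `d₁` and `d₂` are the first two derivatives of the disturbances `d` after `t₀`, bounded by
`D`. -/
structure HasBoundedDerivs (d d₁ d₂ : Fin N → ℝ → Plane) (t₀ D : ℝ) : Prop where
  hasDerivAt : ∀ i t, t₀ < t → HasDerivAt (d i) (d₁ i t) t
  hasDerivAt_deriv : ∀ i t, t₀ < t → HasDerivAt (d₁ i) (d₂ i t) t
  norm_deriv_le : ∀ i t, t₀ ≤ t → ‖d₁ i t‖ ≤ D
  norm_deriv_deriv_le : ∀ i t, t₀ ≤ t → ‖d₂ i t‖ ≤ D
  absolutelyContinuous : ∀ i τ, t₀ ≤ τ → AbsolutelyContinuousOnInterval (d i) t₀ τ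
  absolutelyContinuous_deriv : ∀ i τ, t₀ ≤ τ → AbsolutelyContinuousOnInterval (d₁ i) t₀ τ

theorem AdmissibleDisturbance.exists_hasBoundedDerivs {t₀ : ℝ} {d : Fin N → ℝ → Plane}
    (hd : AdmissibleDisturbance t₀ d) : ∃ d₁ d₂ D, HasBoundedDerivs d d₁ d₂ t₀ D := by
  choose hC h₁ h₂ using hd
  choose C₁ hC₁ using h₁
  choose C₂ hC₂ using h₂
  obtain ⟨D₁, hD₁⟩ := Finite.exists_le C₁
  obtain ⟨D₂, hD₂⟩ := Finite.exists_le C₂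
  have hC' (i : Fin N) : ContDiffOn ℝ 1 (derivWithin (d i) (Set.Ici t₀)) (Set.Ici t₀) :=
    (hC i).derivWithin (uniqueDiffOn_Ici t₀) one_add_one_eq_two.le
  have hderiv {f : ℝ → Plane} (hf : ContDiffOn ℝ 1 f (Set.Ici t₀)) (t : ℝ) (ht : t₀ < t) :
      HasDerivAt f (derivWithin f (Set.Ici t₀) t) t :=
    (hf.differentiableOn one_ne_zero t ht.le).hasDerivWithinAt.hasDerivAt (Ici_mem_nhds ht)
  have hac {f : ℝ → Plane} (hf : ContDiffOn ℝ 1 f (Set.Ici t₀)) (τ : ℝ) (hτ : t₀ ≤ τ) :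
      AbsolutelyContinuousOnInterval f t₀ τ :=
    (hf.mono (Set.uIcc_of_le hτ ▸ Set.Icc_subset_Ici_self)).absolutelyContinuousOnInterval
  refine ⟨fun i => derivWithin (d i) (Set.Ici t₀),
    fun i => derivWithin (derivWithin (d i) (Set.Ici t₀)) (Set.Ici t₀), max D₁ D₂,
    fun i => hderiv ((hC i).of_le one_le_two), fun i => hderiv (hC' i), fun i t ht => ?_,
    fun i t ht => ?_, fun i => hac ((hC i).of_le one_le_two), fun i => hac (hC' i)⟩
  · rw [← iteratedDerivWithin_one]
    exact (hC₁ i t ht).trans ((hD₁ i).trans (le_max_left _ _))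
  · rw [← iteratedDerivWithin_one (f := d i), ← iteratedDerivWithin_succ]
    exact (hC₂ i t ht).trans ((hD₂ i).trans (le_max_right _ _))

/-- The pointwise derivatives of the state along the closed loop, with signum selections `σ`. -/
structure Loop.SatisfiesAt (P : Loop N) (X : ℝ → State N) (t : ℝ) (σ : Profile N) : Prop where
  mem_SGN : ∀ i l, σ i l ∈ SGN ((X t).ζ₁ i l)
  hasDerivAt_x : ∀ i, HasDerivAt (fun t => (X t).x i) (P.xDot t (X t) i) t
  hasDerivAt_y : ∀ i j, HasDerivAt (fun t => (X t).y i j) (P.yDot (X t) i j) t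
  hasDerivAt_xh : ∀ i, HasDerivAt (fun t => (X t).xh i) (P.xhDot (X t) i) t
  hasDerivAt_zh : ∀ i, HasDerivAt (fun t => (X t).zh i)
    ((P.K.ks i * P.K.c i) • (X t).ζ₁ i + P.K.β i • σ i) t
  differentiableAt_abs : ∀ i l, DifferentiableAt ℝ (fun t => |(X t).ζ₁ i l|) t

section ClosedLoop

variable {P : Loop N} {X : ℝ → State N} {t t₀ τ : ℝ} {σ v v' : Profile N}

theorem IsSolutionOn.absolutelyContinuous_ζ₁ (hX : IsSolutionOn P t₀ τ X) (i : Fin N) :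
    AbsolutelyContinuousOnInterval (fun t => (X t).ζ₁ i) t₀ τ :=
  (hX.ac_x i).fun_sub (hX.ac_xh i)

theorem IsSolutionOn.ae_satisfiesAt (hX : IsSolutionOn P t₀ τ X) (hτ : t₀ ≤ τ) :
    ∀ᵐ t, t ∈ Set.Icc t₀ τ → t₀ < t ∧ ∃ σ, P.SatisfiesAt X t σ := by
  have hne : ∀ᵐ t : ℝ, t ≠ t₀ := compl_mem_ae_iff.2 (measure_singleton t₀)
  have habs := ae_all_iff.2 fun i => ae_all_iff.2 fun l => (absolutelyContinuous_abs
    (absolutelyContinuous_apply (hX.absolutelyContinuous_ζ₁ i) l)).ae_differentiableAt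
  rw [Set.uIcc_of_le hτ] at habs
  filter_upwards [hne, ae_imp_of_ae_restrict (ae_all_iff.2 hX.eq_x),
    ae_imp_of_ae_restrict (ae_all_iff.2 fun i => ae_all_iff.2 (hX.eq_y i)),
    ae_imp_of_ae_restrict (ae_all_iff.2 hX.eq_xh), ae_imp_of_ae_restrict (ae_all_iff.2 hX.eq_zh),
    habs] with t hne hx hy hxh hzh habs ht
  choose w hw hzh using hzh ht
  choose σ hσ hw using hw
  exact ⟨lt_of_le_of_ne ht.1 hne.symm, σ, hσ, hx ht, hy ht, hxh ht, fun i => hw i ▸ hzh i,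
    fun i l => habs i l ht⟩

namespace Loop.SatisfiesAt

theorem hasDerivAt_ζ₁ (h : P.SatisfiesAt X t σ) (i : Fin N) :
    HasDerivAt (fun t => (X t).ζ₁ i) (P.ζ₁Dot t (X t) i) t := by
  refine ((h.hasDerivAt_x i).sub (h.hasDerivAt_xh i)).congr_deriv ?_
  simp only [Loop.xDot, Loop.xhDot, Loop.u, State.ζ₁, ζ₁Dot, ψ, mismatch]
  module

theorem hasDerivAt_ψ (h : P.SatisfiesAt X t σ) {i : Fin N} (hg : Differentiable ℝ (P.g i))
    (hd : HasDerivAt (P.d i) (v i) t) :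
    HasDerivAt (fun t => P.ψ t (X t) i) (P.ψDot σ v t (X t) i) t := by
  have hgxh := (hg (X t).xh).hasFDerivAt.comp_hasDerivAt t (hasDerivAt_pi.2 h.hasDerivAt_xh)
  refine (((hgxh.add hd).sub (h.hasDerivAt_zh i)).sub
    ((h.hasDerivAt_ζ₁ i).const_smul (P.K.ks i))).congr_deriv ?_
  simp only [ζ₁Dot, ψDot]
  module

theorem hasDerivAt_formationEnergy (h : P.SatisfiesAt X t σ) (u : Fin N → ℝ) (xs : Profile N) :
    HasDerivAt (fun t => P.formationEnergy u xs (X t)) (P.formationRate u xs (X t)) t := by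
  have hξ (i : Fin N) : HasDerivAt (fun t => u i * ‖(X t).ξh xs i‖ ^ 2)
      (2 * u i * inner ℝ ((X t).ξh xs i) (P.xhDot (X t) i)) t :=
    ((((h.hasDerivAt_xh i).sub_const (xs i)).norm_sq).const_mul (u i)).congr_deriv
      (by rw [State.ξh]; ring)
  have hη (i j : Fin N) : HasDerivAt (fun t => (P.K.θbar i j)⁻¹ * ‖(X t).ηh i j‖ ^ 2)
      (2 * (P.K.θbar i j)⁻¹ * inner ℝ ((X t).ηh i j) (P.yDot (X t) i j - P.xhDot (X t) j)) t :=
    ((((h.hasDerivAt_y i j).fun_sub (h.hasDerivAt_xh j)).norm_sq).const_mul _).congr_deriv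
      (by rw [State.ηh]; ring)
  exact (HasDerivAt.fun_sum fun i _ => hξ i).fun_add
    (HasDerivAt.fun_sum fun i _ => HasDerivAt.fun_sum fun j _ => hη i j)

theorem hasDerivAt_lyapunov (h : P.SatisfiesAt X t σ) (hg : ∀ i, Differentiable ℝ (P.g i))
    {d₁ : Fin N → ℝ → Plane} (hd : ∀ i, HasDerivAt (P.d i) (d₁ i t) t)
    (hd₁ : ∀ i, HasDerivAt (d₁ i) (v' i) t) (u : Fin N → ℝ) (xs : Profile N) (lam : ℝ) :
    HasDerivAt (fun t => P.lyapunov u xs lam (fun i => d₁ i t) t (X t))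
      (P.lyapunovRate u xs lam σ (fun i => d₁ i t) v' t (X t)) t :=
  (h.hasDerivAt_formationEnergy u xs).fun_add <| .const_mul lam <| .fun_sum fun i _ =>
    hasDerivAt_observerEnergy (h.hasDerivAt_ζ₁ i) (h.hasDerivAt_ψ (hg i) (hd i)) (hd₁ i)
      (h.differentiableAt_abs i) (h.mem_SGN i)

end Loop.SatisfiesAt

theorem IsSolutionOn.absolutelyContinuous_ψ (hX : IsSolutionOn P t₀ τ X) {i : Fin N}
    (hg : ContDiff ℝ 1 (P.g i)) (hd : AbsolutelyContinuousOnInterval (P.d i) t₀ τ) :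
    AbsolutelyContinuousOnInterval (fun t => P.ψ t (X t) i) t₀ τ :=
  (((absolutelyContinuous_comp hg.locallyLipschitz (absolutelyContinuous_pi hX.ac_xh)).fun_add
    hd).fun_sub (hX.ac_zh i)).fun_sub ((hX.absolutelyContinuous_ζ₁ i).const_smul (P.K.ks i))

theorem IsSolutionOn.absolutelyContinuous_lyapunov (hX : IsSolutionOn P t₀ τ X)
    (hg : ∀ i, ContDiff ℝ 1 (P.g i)) (hd : ∀ i, AbsolutelyContinuousOnInterval (P.d i) t₀ τ)
    {d₁ : Fin N → ℝ → Plane} (hd₁ : ∀ i, AbsolutelyContinuousOnInterval (d₁ i) t₀ τ)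
    (u : Fin N → ℝ) (xs : Profile N) (lam : ℝ) :
    AbsolutelyContinuousOnInterval
      (fun t => P.lyapunov u xs lam (fun i => d₁ i t) t (X t)) t₀ τ := by
  have hconst (x : Plane) : AbsolutelyContinuousOnInterval (fun _ : ℝ => x) t₀ τ :=
    contDiff_const.contDiffOn.absolutelyContinuousOnInterval
  have hξ (i : Fin N) : AbsolutelyContinuousOnInterval (fun t => (X t).ξh xs i) t₀ τ :=
    (hX.ac_xh i).fun_sub (hconst (xs i))
  have hη (i j : Fin N) : AbsolutelyContinuousOnInterval (fun t => (X t).ηh i j) t₀ τ :=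
    (hX.ac_y i j).fun_sub (hX.ac_xh j)
  refine .fun_add (.fun_add (absolutelyContinuous_sum fun i => ?_) (absolutelyContinuous_sum
    fun i => absolutelyContinuous_sum fun j => ?_)) (.const_mul _ (absolutelyContinuous_sum
    fun i => ?_))
  · exact (absolutelyContinuous_norm_sq (hξ i)).const_mul _
  · exact (absolutelyContinuous_norm_sq (hη i j)).const_mul _
  · exact absolutelyContinuous_observerEnergy (hX.absolutelyContinuous_ζ₁ i)
      (hX.absolutelyContinuous_ψ (hg i) (hd i)) (hd₁ i)

end ClosedLoop

namespace Loop

section Confinement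

variable {P : Loop N} {s : State N} {t : ℝ} {xs v : Profile N} {u : Fin N → ℝ}
  {k : StabilityConstants}

theorem IsTuned.m_le_U (hT : P.IsTuned xs u k) (i : Fin N) : k.m ≤ k.U :=
  (hT.weights.le_weight i).trans (hT.weights.weight_le i)

theorem IsTuned.lam_pos (hT : P.IsTuned xs u k) (i : Fin N) : 0 < k.lam N := by
  have := hT.weights.lower_pos.trans_le (hT.m_le_U i)
  have := hT.R_pos
  unfold StabilityConstants.lam
  positivity

theorem IsTuned.m_mul_R_le_half_lam (hT : P.IsTuned xs u k) (i : Fin N) :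
    k.m * k.R ≤ k.lam N / 2 := by
  have hR := hT.R_pos.le
  have hRU := mul_nonneg hR hT.U_nonneg
  have hNRU := mul_nonneg N.cast_nonneg hRU
  have hmU := mul_le_mul_of_nonneg_right (hT.m_le_U i) hR
  unfold StabilityConstants.lam
  linarith

section LowerBounds

variable (hT : P.IsTuned xs u k) (hv : ∀ i, ‖v i‖ ≤ k.D)

include hT hv

theorem IsTuned.m_mul_formationNormSq_le :
    k.m * s.formationNormSq xs ≤ P.lyapunov u xs (k.lam N) v t s :=
  (le_add_of_nonneg_right (mul_nonneg hT.lam_nonneg (Finset.sum_nonneg fun i _ => by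
    have := hT.β_pos i
    positivity))).trans (hT.le_lyapunov hv)

theorem IsTuned.lam_mul_observer_le (i : Fin N) :
    k.lam N * (1 / (2 * P.K.β i) * ‖P.ψ t s i‖ ^ 2 + 1 / 2 * ‖s.ζ₁ i‖) ≤
      P.lyapunov u xs (k.lam N) v t s := by
  refine le_trans ?_ (hT.le_lyapunov hv)
  refine le_add_of_nonneg_of_le (mul_nonneg hT.weights.lower_pos.le (s.formationNormSq_nonneg xs))
    (mul_le_mul_of_nonneg_left ?_ hT.lam_nonneg)
  refine Finset.single_le_sum
    (f := fun i => 1 / (2 * P.K.β i) * ‖P.ψ t s i‖ ^ 2 + 1 / 2 * ‖s.ζ₁ i‖) (fun i _ => ?_)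
    (Finset.mem_univ i)
  have := hT.β_pos i
  positivity

theorem IsTuned.lyapunov_nonneg : 0 ≤ P.lyapunov u xs (k.lam N) v t s :=
  (mul_nonneg hT.weights.lower_pos.le (s.formationNormSq_nonneg xs)).trans
    (hT.m_mul_formationNormSq_le hv)

end LowerBounds

theorem IsTuned.confinedTo (hT : P.IsTuned xs u k) (hv : ∀ i, ‖v i‖ ≤ k.D)
    (hV : P.lyapunov u xs (k.lam N) v t s ≤ k.m * k.R ^ 2) : s.ConfinedTo xs k.R := by
  have hm := hT.weights.lower_pos
  have hR := hT.R_pos.le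
  have hW : s.formationNormSq xs ≤ k.R ^ 2 :=
    le_of_mul_le_mul_left ((hT.m_mul_formationNormSq_le hv).trans hV) hm
  refine ⟨fun i => ?_, fun i j => ?_, fun i => ?_⟩
  · exact le_of_sq_le_sq ((s.norm_ξh_sq_le xs i).trans hW) hR
  · exact le_of_sq_le_sq ((s.norm_ηh_sq_le xs i j).trans hW) hR
  · have hlam := hT.lam_pos i
    have hψ : 0 ≤ k.lam N * (1 / (2 * P.K.β i) * ‖P.ψ t s i‖ ^ 2) := by
      have := hT.β_pos i
      positivity
    have hmR := mul_le_mul_of_nonneg_right (hT.m_mul_R_le_half_lam i) hR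
    refine le_of_mul_le_mul_left ?_ (half_pos hlam)
    linarith [(hT.lam_mul_observer_le (t := t) (s := s) hv i).trans hV]

theorem IsTuned.norm_ψ_sq_le (hT : P.IsTuned xs u k) (hv : ∀ i, ‖v i‖ ≤ k.D) (i : Fin N) :
    ‖P.ψ t s i‖ ^ 2 ≤ 2 * P.K.β i / k.lam N * P.lyapunov u xs (k.lam N) v t s := by
  have hβ := hT.β_pos i
  have hlam := hT.lam_pos i
  calc ‖P.ψ t s i‖ ^ 2
      = 2 * P.K.β i / k.lam N * (k.lam N * (1 / (2 * P.K.β i) * ‖P.ψ t s i‖ ^ 2)) := by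
        field_simp
    _ ≤ 2 * P.K.β i / k.lam N *
          (k.lam N * (1 / (2 * P.K.β i) * ‖P.ψ t s i‖ ^ 2 + 1 / 2 * ‖s.ζ₁ i‖)) := by
        gcongr
        exact le_add_of_nonneg_right (by positivity)
    _ ≤ 2 * P.K.β i / k.lam N * P.lyapunov u xs (k.lam N) v t s := by
        gcongr
        exact hT.lam_mul_observer_le hv i

theorem IsTuned.norm_ζ₁_sq_le (hT : P.IsTuned xs u k) (hv : ∀ i, ‖v i‖ ≤ k.D)
    (hR : s.ConfinedTo xs k.R) (i : Fin N) :
    ‖s.ζ₁ i‖ ^ 2 ≤ 2 * k.R / k.lam N * P.lyapunov u xs (k.lam N) v t s := by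
  have hβ := hT.β_pos i
  have hlam := hT.lam_pos i
  have hR₀ := hT.R_pos
  calc ‖s.ζ₁ i‖ ^ 2 = ‖s.ζ₁ i‖ * ‖s.ζ₁ i‖ := sq _
    _ ≤ k.R * ‖s.ζ₁ i‖ := mul_le_mul_of_nonneg_right (hR.ζ₁_le i) (norm_nonneg _)
    _ = 2 * k.R / k.lam N * (k.lam N * (1 / 2 * ‖s.ζ₁ i‖)) := by field_simp
    _ ≤ 2 * k.R / k.lam N *
          (k.lam N * (1 / (2 * P.K.β i) * ‖P.ψ t s i‖ ^ 2 + 1 / 2 * ‖s.ζ₁ i‖)) := by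
        gcongr
        exact le_add_of_nonneg_left (by positivity)
    _ ≤ 2 * k.R / k.lam N * P.lyapunov u xs (k.lam N) v t s := by
        gcongr
        exact hT.lam_mul_observer_le hv i

theorem IsTuned.exists_norm_le_sqrt_lyapunov (hT : P.IsTuned xs u k) :
    ∃ C, 0 ≤ C ∧ ∀ (t : ℝ) (s : State N) (v : Profile N), (∀ i, ‖v i‖ ≤ k.D) →
      s.ConfinedTo xs k.R → s.ConfinedTo xs √(C * P.lyapunov u xs (k.lam N) v t s) ∧
        ∀ i, ‖P.ψ t s i‖ ≤ √(C * P.lyapunov u xs (k.lam N) v t s) := by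
  have hm := hT.weights.lower_pos
  obtain ⟨B, hB⟩ := Finite.exists_le fun i => 2 * P.K.β i / k.lam N
  refine ⟨max (1 / k.m) (max (2 * k.R / k.lam N) B), (one_div_pos.2 hm).le.trans (le_max_left _ _),
    fun t s v hv hR => ?_⟩
  have hV := hT.lyapunov_nonneg (t := t) (s := s) hv
  have hW : s.formationNormSq xs ≤ 1 / k.m * P.lyapunov u xs (k.lam N) v t s := by
    rw [one_div_mul_eq_div, le_div_iff₀' hm]
    exact hT.m_mul_formationNormSq_le hv
  have hsqrt {b C a : ℝ} (ha : a ^ 2 ≤ b * P.lyapunov u xs (k.lam N) v t s) (hbC : b ≤ C) :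
      a ≤ √(C * P.lyapunov u xs (k.lam N) v t s) :=
    Real.le_sqrt_of_sq_le (ha.trans (mul_le_mul_of_nonneg_right hbC hV))
  have hRC := (le_max_left (2 * k.R / k.lam N) B).trans (le_max_right (1 / k.m) _)
  have hBC := (le_max_right (2 * k.R / k.lam N) B).trans (le_max_right (1 / k.m) _)
  exact ⟨⟨fun i => hsqrt ((s.norm_ξh_sq_le xs i).trans hW) (le_max_left _ _),
    fun i j => hsqrt ((s.norm_ηh_sq_le xs i j).trans hW) (le_max_left _ _),
    fun i => hsqrt (hT.norm_ζ₁_sq_le hv hR i) hRC⟩,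
    fun i => hsqrt (hT.norm_ψ_sq_le hv i) ((hB i).trans hBC)⟩

end Confinement

section ErrNorm

variable {P : Loop N} {t : ℝ} {s : State N} {xs : Profile N}

theorem γ_eq (P : Loop N) (t : ℝ) (s : State N) (i : Fin N) :
    P.γ t s i = P.ψ t s i + P.mismatch s i := by
  simp only [γ, ψ, mismatch, xDot, xhDot, State.ζ₁, add_smul]
  abel

theorem ζ₂_eq (P : Loop N) (t : ℝ) (s : State N) (i : Fin N) :
    P.ζ₂ t s i = P.γ t s i + P.K.ks i • s.ζ₁ i := by
  simp only [γ, ζ₂, z, xDot, xhDot, State.ζ₁, add_smul]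
  abel

theorem norm_ζ₁_le_errNorm (i : Fin N) : ‖s.ζ₁ i‖ ≤ P.errNorm xs t s := by
  refine Real.le_sqrt_of_sq_le ((norm_sq_le_sum s.ζ₁ i).trans ?_)
  simp only [add_assoc]
  exact le_add_of_nonneg_right (by positivity)

theorem norm_η_le_errNorm (i j : Fin N) : ‖s.η i j‖ ≤ P.errNorm xs t s := by
  refine Real.le_sqrt_of_sq_le ((norm_sq_le_sum (s.η i) j).trans ?_)
  rw [add_assoc, add_assoc]
  refine le_add_of_nonneg_of_le (by positivity) (le_add_of_le_of_nonneg ?_ (by positivity))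
  exact Finset.single_le_sum (f := fun i => ∑ j, ‖s.η i j‖ ^ 2) (fun i _ => by positivity)
    (Finset.mem_univ i)

theorem norm_ξ_le_errNorm (i : Fin N) : ‖s.ξ xs i‖ ≤ P.errNorm xs t s := by
  refine Real.le_sqrt_of_sq_le ((norm_sq_le_sum (s.ξ xs) i).trans ?_)
  rw [add_assoc]
  exact le_add_of_nonneg_of_le (by positivity) (le_add_of_nonneg_right (by positivity))

theorem norm_γ_le_errNorm (i : Fin N) : ‖P.γ t s i‖ ≤ P.errNorm xs t s :=
  Real.le_sqrt_of_sq_le <| (norm_sq_le_sum (P.γ t s) i).trans <|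
    le_add_of_nonneg_left (by positivity)

theorem errNorm_le {b : ℝ} (hb : 0 ≤ b) (hζ₁ : ∀ i, ‖s.ζ₁ i‖ ≤ b) (hζ₂ : ∀ i, ‖P.ζ₂ t s i‖ ≤ b)
    (hη : ∀ i j, ‖s.η i j‖ ≤ b) (hξ : ∀ i, ‖s.ξ xs i‖ ≤ b) (hγ : ∀ i, ‖P.γ t s i‖ ≤ b) :
    P.errNorm xs t s ≤ √(4 * N + N ^ 2) * b := by
  rw [errNorm, ← Real.sqrt_sq hb, ← Real.sqrt_mul (by positivity)]
  refine Real.sqrt_le_sqrt ?_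
  calc (∑ i, ‖s.ζ₁ i‖ ^ 2) + (∑ i, ‖P.ζ₂ t s i‖ ^ 2) + (∑ i, ∑ j, ‖s.η i j‖ ^ 2)
        + (∑ i, ‖s.ξ xs i‖ ^ 2) + ∑ i, ‖P.γ t s i‖ ^ 2
      ≤ (∑ _i : Fin N, b ^ 2) + (∑ _i : Fin N, b ^ 2) + (∑ _i : Fin N, ∑ _j : Fin N, b ^ 2)
        + (∑ _i : Fin N, b ^ 2) + ∑ _i : Fin N, b ^ 2 := by
        gcongr with i _ i _ i _ j _ i _ i _
        exacts [hζ₁ i, hζ₂ i, hη i j, hξ i, hγ i]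
    _ = (4 * N + N ^ 2) * b ^ 2 := by
        simp only [Finset.sum_const, Finset.card_univ, Fintype.card_fin, nsmul_eq_mul]
        ring

theorem IsTuned.errNorm_le {u : Fin N → ℝ} {k : StabilityConstants} (hT : P.IsTuned xs u k)
    (hR : s.ConfinedTo xs k.R) {w : ℝ} (hw : 0 ≤ w) (hs : s.ConfinedTo xs w)
    (hψ : ∀ i, ‖P.ψ t s i‖ ≤ w) :
    P.errNorm xs t s ≤ √(4 * N + N ^ 2) * ((2 + N * k.ℓ + |k.K|) * w) := by
  have hℓ := hT.bounded.nonneg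
  have hℓw : 0 ≤ N * k.ℓ * w := by positivity
  have hKw : 0 ≤ |k.K| * w := by positivity
  have hsum : ∑ j, ‖s.ζ₁ j‖ ≤ N * w := by
    simpa using Finset.sum_le_card_nsmul _ _ _ fun j (_ : j ∈ Finset.univ) => hs.ζ₁_le j
  have hγ (i : Fin N) : ‖P.γ t s i‖ ≤ (1 + N * k.ℓ) * w := by
    rw [γ_eq]
    have := mul_le_mul_of_nonneg_left hsum hℓ
    linarith [norm_add_le (P.ψ t s i) (P.mismatch s i), hψ i, hT.norm_mismatch_le hR i]
  have hks (i : Fin N) : ‖P.K.ks i • s.ζ₁ i‖ ≤ |k.K| * w := by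
    rw [norm_smul, Real.norm_of_nonneg (hT.ks_nonneg i)]
    gcongr
    exacts [(hT.ks_le i).trans (le_abs_self k.K), hs.ζ₁_le i]
  refine Loop.errNorm_le (by positivity) (fun i => ?_) (fun i => ?_) (fun i j => ?_) (fun i => ?_)
    fun i => ?_
  · linarith [hs.ζ₁_le i]
  · rw [ζ₂_eq]
    linarith [norm_add_le (P.γ t s i) (P.K.ks i • s.ζ₁ i), hγ i, hks i]
  · rw [← s.ηh_sub_ζ₁]
    linarith [norm_sub_le (s.ηh i j) (s.ζ₁ j), hs.ηh_le i j, hs.ζ₁_le j]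
  · rw [← s.ξh_add_ζ₁]
    linarith [norm_add_le (s.ξh xs i) (s.ζ₁ i), hs.ξh_le i, hs.ζ₁_le i]
  · linarith [hγ i]

end ErrNorm

end Loop

theorem State.ConfinedTo.formationNormSq_le {s : State N} {xs : Profile N} {r : ℝ}
    (h : s.ConfinedTo xs r) : s.formationNormSq xs ≤ r ^ 2 * (N + N ^ 2) := by
  calc s.formationNormSq xs
      ≤ ∑ _i : Fin N, r ^ 2 + ∑ _i : Fin N, ∑ _j : Fin N, r ^ 2 := by
        unfold formationNormSq
        gcongr with i _ i _ j
        exacts [h.ξh_le i, h.ηh_le i j]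
    _ = r ^ 2 * (N + N ^ 2) := by
        simp only [Finset.sum_const, Finset.card_univ, Fintype.card_fin, nsmul_eq_mul]
        ring

namespace Loop

/-- The loop is tuned for initial errors of norm at most `v₁`: these place the Lyapunov function
below its barrier `m * R ^ 2`. -/
structure IsTunedFor (P : Loop N) (xs : Profile N) (u : Fin N → ℝ) (k : StabilityConstants)
    (v₁ : ℝ) : Prop extends P.IsTuned xs u k where
  two_mul_le_R : 2 * v₁ ≤ k.R
  sq_le_β : ∀ i, (v₁ + k.ℓ * (N * v₁)) ^ 2 ≤ P.K.β i
  initial_lt_barrier :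
    4 * v₁ ^ 2 * (N + N ^ 2) * k.U + k.lam N * (N * (1 + 3 * v₁)) < k.m * k.R ^ 2

section InitialState

variable {P : Loop N} {t v₁ : ℝ} {s : State N} {xs : Profile N} {u : Fin N → ℝ}
  {k : StabilityConstants}

theorem confinedTo_of_errNorm_le (hv₁ : P.errNorm xs t s ≤ v₁) : s.ConfinedTo xs (2 * v₁) := by
  have hζ₁ (i : Fin N) : ‖s.ζ₁ i‖ ≤ v₁ := (norm_ζ₁_le_errNorm i).trans hv₁
  refine ⟨fun i => ?_, fun i j => ?_, fun i => ?_⟩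
  · rw [eq_sub_of_add_eq (s.ξh_add_ζ₁ xs i)]
    linarith [norm_sub_le (s.ξ xs i) (s.ζ₁ i), (norm_ξ_le_errNorm i).trans hv₁, hζ₁ i]
  · rw [eq_add_of_sub_eq (s.ηh_sub_ζ₁ i j)]
    linarith [norm_add_le (s.η i j) (s.ζ₁ j), (norm_η_le_errNorm i j).trans hv₁, hζ₁ j]
  · linarith [hζ₁ i, norm_nonneg (s.ζ₁ i)]

theorem IsTuned.norm_ψ_le (hT : P.IsTuned xs u k) (hv₁ : P.errNorm xs t s ≤ v₁)
    (hR : s.ConfinedTo xs k.R) (i : Fin N) : ‖P.ψ t s i‖ ≤ v₁ + k.ℓ * (N * v₁) := by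
  have hsum : ∑ j, ‖s.ζ₁ j‖ ≤ N * v₁ := by
    simpa using Finset.sum_le_card_nsmul _ _ _ fun j (_ : j ∈ Finset.univ) =>
      (norm_ζ₁_le_errNorm (P := P) j).trans hv₁
  rw [eq_sub_of_add_eq (P.γ_eq t s i).symm]
  exact (norm_sub_le _ _).trans <| add_le_add ((norm_γ_le_errNorm i).trans hv₁) <|
    (hT.norm_mismatch_le hR i).trans (mul_le_mul_of_nonneg_left hsum hT.bounded.nonneg)

theorem IsTunedFor.lyapunov_lt {v : Profile N} (hT : P.IsTunedFor xs u k v₁)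
    (hv : ∀ i, ‖v i‖ ≤ k.D) (hv₁ : P.errNorm xs t s ≤ v₁) :
    P.lyapunov u xs (k.lam N) v t s < k.m * k.R ^ 2 := by
  have hU := hT.U_nonneg
  have hlam := hT.lam_nonneg
  have hconf := confinedTo_of_errNorm_le hv₁
  have hR : s.ConfinedTo xs k.R :=
    ⟨fun i => (hconf.ξh_le i).trans hT.two_mul_le_R,
      fun i j => (hconf.ηh_le i j).trans hT.two_mul_le_R,
      fun i => (hconf.ζ₁_le i).trans hT.two_mul_le_R⟩
  have hobs (i : Fin N) : 1 / (2 * P.K.β i) * ‖P.ψ t s i‖ ^ 2 + 3 * ‖s.ζ₁ i‖ ≤ 1 + 3 * v₁ := by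
    have hβ := hT.β_pos i
    have hψ := (pow_le_pow_left₀ (norm_nonneg _) (hT.norm_ψ_le hv₁ hR i) 2).trans (hT.sq_le_β i)
    have hdiv : 1 / (2 * P.K.β i) * ‖P.ψ t s i‖ ^ 2 ≤ 1 := by
      rw [one_div_mul_eq_div, div_le_one (by positivity)]
      linarith
    linarith [(norm_ζ₁_le_errNorm (P := P) (t := t) (xs := xs) (s := s) i).trans hv₁]
  calc P.lyapunov u xs (k.lam N) v t s
      ≤ k.U * s.formationNormSq xs +
          k.lam N * ∑ i, (1 / (2 * P.K.β i) * ‖P.ψ t s i‖ ^ 2 + 3 * ‖s.ζ₁ i‖) :=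
        hT.lyapunov_le hv
    _ ≤ k.U * ((2 * v₁) ^ 2 * (N + N ^ 2)) + k.lam N * ∑ _i : Fin N, (1 + 3 * v₁) := by
        gcongr _ * ?_ + _ * ?_
        exacts [hconf.formationNormSq_le, Finset.sum_le_sum fun i _ => hobs i]
    _ = 4 * v₁ ^ 2 * (N + N ^ 2) * k.U + k.lam N * (N * (1 + 3 * v₁)) := by
        rw [Finset.sum_const, Finset.card_univ, Fintype.card_fin, nsmul_eq_mul]
        ring
    _ < k.m * k.R ^ 2 := hT.initial_lt_barrier

end InitialState

section Trajectories

variable {P : Loop N} {t₀ τ t v₁ : ℝ} {X : ℝ → State N} {xs : Profile N} {u : Fin N → ℝ}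
  {k : StabilityConstants} {d₁ d₂ : Fin N → ℝ → Plane}

theorem IsTuned.rate_pos (hT : P.IsTuned xs u k) : 0 < k.rate := by
  have := hT.U_nonneg
  unfold StabilityConstants.rate
  positivity

theorem IsTuned.lyapunov_le_exp_mul (hT : P.IsTuned xs u k) (hg : ∀ i, ContDiff ℝ 1 (P.g i))
    (hd : HasBoundedDerivs P.d d₁ d₂ t₀ k.D) (hX : IsSolutionOn P t₀ τ X)
    (h₀ : P.lyapunov u xs (k.lam N) (fun i => d₁ i t₀) t₀ (X t₀) < k.m * k.R ^ 2)
    (ht : t ∈ Set.Icc t₀ τ) :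
    P.lyapunov u xs (k.lam N) (fun i => d₁ i t) t (X t) ≤
      Real.exp (-k.rate * (t - t₀)) *
        P.lyapunov u xs (k.lam N) (fun i => d₁ i t₀) t₀ (X t₀) := by
  have hτ := ht.1.trans ht.2
  refine le_exp_mul_of_barrier (f := fun t => P.lyapunov u xs (k.lam N) (fun i => d₁ i t) t (X t))
    hT.rate_pos.le (hX.absolutelyContinuous_lyapunov hg (fun i => hd.absolutelyContinuous i τ hτ)
      (fun i => hd.absolutelyContinuous_deriv i τ hτ) u xs (k.lam N)) h₀ ?_ ht
  filter_upwards [hX.ae_satisfiesAt hτ] with r hr hrI hV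
  obtain ⟨hr₀, σ, hσ⟩ := hr hrI
  have hv (i : Fin N) : ‖d₁ i r‖ ≤ k.D := hd.norm_deriv_le i r hr₀.le
  exact ⟨hT.lyapunov_nonneg hv, _,
    hσ.hasDerivAt_lyapunov (fun i => (hg i).differentiable one_ne_zero)
      (fun i => hd.hasDerivAt i r hr₀) (fun i => hd.hasDerivAt_deriv i r hr₀) u xs (k.lam N),
    hT.lyapunovRate_le (hT.confinedTo hv hV) hσ.mem_SGN hv
      fun i => hd.norm_deriv_deriv_le i r hr₀.le⟩

theorem IsTunedFor.exists_errNorm_le_exp (hT : P.IsTunedFor xs u k v₁)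
    (hg : ∀ i, ContDiff ℝ 1 (P.g i)) (hd : HasBoundedDerivs P.d d₁ d₂ t₀ k.D) :
    ∃ C, ∀ (X : ℝ → State N) (τ : ℝ), IsSolutionOn P t₀ τ X →
      P.errNorm xs t₀ (X t₀) ≤ v₁ → ∀ t ∈ Set.Icc t₀ τ,
        P.errNorm xs t (X t) ≤ C * Real.exp (-(k.rate / 2) * (t - t₀)) := by
  obtain ⟨C, hC, hbound⟩ := hT.exists_norm_le_sqrt_lyapunov
  refine ⟨√(4 * N + N ^ 2) * ((2 + N * k.ℓ + |k.K|) * √(C * (k.m * k.R ^ 2))),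
    fun X τ hX hv₁ t ht => ?_⟩
  have hℓ := hT.bounded.nonneg
  have hv₀ (i : Fin N) : ‖d₁ i t₀‖ ≤ k.D := hd.norm_deriv_le i t₀ le_rfl
  have hv (i : Fin N) : ‖d₁ i t‖ ≤ k.D := hd.norm_deriv_le i t ht.1
  have h₀ := hT.lyapunov_lt hv₀ hv₁
  set V := P.lyapunov u xs (k.lam N) (fun i => d₁ i t) t (X t)
  have hdecay : V ≤ Real.exp (-k.rate * (t - t₀)) * (k.m * k.R ^ 2) :=
    (hT.lyapunov_le_exp_mul hg hd hX h₀ ht).trans (by gcongr)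
  have hbarrier : V ≤ k.m * k.R ^ 2 := by
    refine hdecay.trans (mul_le_of_le_one_left ?_ (Real.exp_le_one_iff.2 ?_))
    · exact (hT.lyapunov_nonneg hv₀).trans h₀.le
    · exact mul_nonpos_of_nonpos_of_nonneg (neg_nonpos.2 hT.rate_pos.le) (sub_nonneg.2 ht.1)
  have hsqrt : √(C * V) ≤ √(C * (k.m * k.R ^ 2)) * Real.exp (-(k.rate / 2) * (t - t₀)) := by
    have hexp : -(k.rate / 2) * (t - t₀) = -k.rate * (t - t₀) / 2 := by ring
    rw [hexp, Real.exp_half, ← Real.sqrt_mul' _ (Real.exp_pos _).le, mul_right_comm]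
    exact Real.sqrt_le_sqrt ((mul_le_mul_of_nonneg_left hdecay hC).trans_eq (by ring))
  have hR := hT.confinedTo hv hbarrier
  obtain ⟨hconf, hψ⟩ := hbound t (X t) _ hv hR
  calc P.errNorm xs t (X t) ≤ √(4 * N + N ^ 2) * ((2 + N * k.ℓ + |k.K|) * √(C * V)) :=
        hT.errNorm_le hR (Real.sqrt_nonneg _) hconf hψ
    _ ≤ √(4 * N + N ^ 2) * ((2 + N * k.ℓ + |k.K|) *
          (√(C * (k.m * k.R ^ 2)) * Real.exp (-(k.rate / 2) * (t - t₀)))) := by gcongr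
    _ = _ := by ring

end Trajectories

end Loop

section Convergence

theorem tendsto_zero_of_le_mul_exp {f : ℝ → ℝ} {C α t₀ : ℝ} (hα : 0 < α) (hf : ∀ t, 0 ≤ f t)
    (hle : ∀ t, t₀ ≤ t → f t ≤ C * Real.exp (-α * (t - t₀))) : Tendsto f atTop (𝓝 0) := by
  have hexp : Tendsto (fun t => Real.exp (-α * (t - t₀))) atTop (𝓝 0) :=
    Real.tendsto_exp_atBot.comp <|
      (tendsto_atTop_add_const_right _ (-t₀) tendsto_id).const_mul_atTop_of_neg (neg_neg_of_pos hα)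
  have hbound := hexp.const_mul C
  rw [mul_zero] at hbound
  exact squeeze_zero' (Eventually.of_forall hf) ((eventually_ge_atTop t₀).mono hle) hbound

theorem exists_le_and_add_mul_lt_mul_sq {m : ℝ} (hm : 0 < m) (r a b : ℝ) :
    ∃ R, 0 < R ∧ r ≤ R ∧ a + b * R < m * R ^ 2 := by
  have hquad : Tendsto (fun R => (m * R - b) * R) atTop atTop :=
    (tendsto_atTop_add_const_right _ (-b) (tendsto_id.const_mul_atTop hm)).atTop_mul_atTop₀
      tendsto_id
  obtain ⟨R, hR, hr, hlt⟩ := ((eventually_gt_atTop 0).and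
    ((eventually_ge_atTop r).and (hquad.eventually_gt_atTop a))).exists
  exact ⟨R, hR, hr, by linarith⟩

variable {P : Loop N} {t₀ v₁ : ℝ} {xs : Profile N} {u : Fin N → ℝ} {k : StabilityConstants}
  {d₁ d₂ : Fin N → ℝ → Plane}

theorem Loop.IsTunedFor.bounded_and_tendsto (hT : P.IsTunedFor xs u k v₁)
    (hg : ∀ i, ContDiff ℝ 1 (P.g i)) (hd : HasBoundedDerivs P.d d₁ d₂ t₀ k.D) :
    (∃ B : ℝ, ∀ (X : ℝ → State N) (τ : ℝ), t₀ ≤ τ → IsSolutionOn P t₀ τ X →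
      P.errNorm xs t₀ (X t₀) ≤ v₁ → ∀ t ∈ Set.Icc t₀ τ, P.errNorm xs t (X t) ≤ B) ∧
    (∀ X : ℝ → State N, (∀ τ, t₀ ≤ τ → IsSolutionOn P t₀ τ X) →
      P.errNorm xs t₀ (X t₀) ≤ v₁ →
      Tendsto (fun t => P.errNorm xs t (X t)) atTop (𝓝 0) ∧
      ∀ i, Tendsto (fun t => (X t).x i) atTop (𝓝 (xs i))) := by
  have hrate := half_pos hT.rate_pos
  obtain ⟨C, hC⟩ := hT.exists_errNorm_le_exp hg hd
  refine ⟨⟨|C|, fun X τ _ hX hv₁ t ht => (hC X τ hX hv₁ t ht).trans ?_⟩, fun X hX hv₁ => ?_⟩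
  · have hexp : Real.exp (-(k.rate / 2) * (t - t₀)) ≤ 1 := Real.exp_le_one_iff.2 <|
      mul_nonpos_of_nonpos_of_nonneg (neg_nonpos.2 hrate.le) (sub_nonneg.2 ht.1)
    exact (mul_le_mul_of_nonneg_right (le_abs_self C) (Real.exp_pos _).le).trans
      (mul_le_of_le_one_right (abs_nonneg C) hexp)
  · have herr : Tendsto (fun t => P.errNorm xs t (X t)) atTop (𝓝 0) :=
      tendsto_zero_of_le_mul_exp hrate (fun _ => Real.sqrt_nonneg _)
        fun t ht => hC X t (hX t ht) hv₁ t ⟨ht, le_rfl⟩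
    exact ⟨herr, fun i => tendsto_iff_norm_sub_tendsto_zero.2 <|
      squeeze_zero (fun _ => norm_nonneg _) (fun _ => Loop.norm_ξ_le_errNorm i) herr⟩

end Convergence

end SensorSeeking

theorem corollary3_general (N : ℕ) (hN : 2 ≤ N) {f : Fin N → Profile N → ℝ} {xs : Profile N}
    {u : Fin N → ℝ} {L : ℝ} (hs : IsDiagonallyStableAt f xs u L) (A : CommGraph N)
    (g : Fin N → Profile N → Plane) (hg : ∀ i, ContDiff ℝ 1 (g i))
    (t₀ : ℝ) (d : Fin N → ℝ → Plane) (hd : AdmissibleDisturbance t₀ d)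
    (θbar : Fin N → Fin N → ℝ) (hθbar : ∀ i j, 0 < θbar i j) (v₁ : ℝ) :
    ∃ θstar : ℝ, 0 < θstar ∧ ∀ θ : ℝ, θstar < θ →
    ∃ kr : ℝ, 0 < kr ∧ ∀ ks : Fin N → ℝ, (∀ i, kr < ks i) →
    ∃ cr : ℝ, 0 < cr ∧ ∀ c : Fin N → ℝ, (∀ i, cr < c i) →
    ∃ βr : ℝ, 0 < βr ∧ ∀ β : Fin N → ℝ, (∀ i, βr < β i) →
    ∀ P : Loop N, P = ⟨f, A, g, d, ⟨θ, θbar, ks, c, β⟩⟩ →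
      (∃ B : ℝ, ∀ (X : ℝ → State N) (τ : ℝ), t₀ ≤ τ → IsSolutionOn P t₀ τ X →
        P.errNorm xs t₀ (X t₀) ≤ v₁ → ∀ t ∈ Set.Icc t₀ τ, P.errNorm xs t (X t) ≤ B) ∧
      (∀ X : ℝ → State N, (∀ τ, t₀ ≤ τ → IsSolutionOn P t₀ τ X) →
        P.errNorm xs t₀ (X t₀) ≤ v₁ →
        Tendsto (fun t => P.errNorm xs t (X t)) atTop (𝓝 0) ∧
        ∀ i, Tendsto (fun t => (X t).x i) atTop (𝓝 (xs i))) := by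
  obtain ⟨μ, hμ, hA⟩ := A.exists_pos_mul_sum_norm_sq_le hN
  obtain ⟨m, U, hW⟩ := exists_weightBounds A hθbar hs.weight_pos
  obtain ⟨d₁, d₂, D, hd'⟩ := hd.exists_hasBoundedDerivs
  obtain ⟨R, hR, hv₁R, hbarrier⟩ := exists_le_and_add_mul_lt_mul_sq hW.lower_pos (2 * v₁)
    (4 * v₁ ^ 2 * (N + N ^ 2) * U) (16 * ((2 + 2 * N) * U) * (N * (1 + 3 * v₁)))
  obtain ⟨ℓ, hℓ⟩ := exists_hasBoundedFDeriv hg xs (2 * R)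
  refine ⟨Loop.thetaThreshold N L U μ, Loop.thetaThreshold_pos hs.lipschitz_nonneg hμ,
    fun θ hθ => ⟨1, one_pos, fun ks hks => ?_⟩⟩
  obtain ⟨κ, hκ⟩ := Finite.exists_le ks
  refine ⟨max 1 (max (θ + κ) (8 * (N * (1 + 3 * ℓ)))), lt_max_of_lt_left one_pos, fun c hc => ?_⟩
  obtain ⟨K, hK⟩ := Finite.exists_le fun i => ks i + c i
  let k : StabilityConstants := ⟨L, m, U, μ, R, ℓ, K, D⟩
  refine ⟨max 1 (max (4 * D) (max ((2 * k.lam N * N + 1) * k.drift N) ((v₁ + ℓ * (N * v₁)) ^ 2))),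
    lt_max_of_lt_left one_pos, fun β hβ => ?_⟩
  simp only [max_lt_iff] at hc hβ
  rintro P rfl
  have hU : 0 ≤ U := hW.lower_pos.le.trans <|
    (hW.le_weight ⟨0, by omega⟩).trans (hW.weight_le ⟨0, by omega⟩)
  refine Loop.IsTunedFor.bounded_and_tendsto (u := u) (k := k) ⟨⟨hs, hW, hU, hμ, hA, hR, hℓ, hθ,
    fun i => (hks i).le, fun i => (hc i).1.le,
    fun i => (add_le_add_right (hκ i) θ).trans (hc i).2.1.le, fun i => (hc i).2.2.le, hK,
    fun i => one_pos.trans (hβ i).1, fun i => (hβ i).2.1.le, fun i => (hβ i).2.2.1.le⟩,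
    hv₁R, fun i => (hβ i).2.2.2.le, ?_⟩ hg hd'
  exact lt_of_eq_of_lt (by simp only [k, StabilityConstants.lam]; ring) hbarrier

theorem corollary3 (N : ℕ) (hN : 2 ≤ N) (G : ConnectivityGame N) (A : CommGraph N)
    (g : Fin N → Profile N → Plane) (hg : ∀ i, ContDiff ℝ 2 (g i))
    (t₀ : ℝ) (d : Fin N → ℝ → Plane) (hd : AdmissibleDisturbance t₀ d)
    (θbar : Fin N → Fin N → ℝ) (hθbar : ∀ i j, 0 < θbar i j) :
    (∃! xs : Profile N, IsNash G.cost xs) ∧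
    ∀ xs : Profile N, IsNash G.cost xs →
    ∀ v₁ : ℝ, 0 < v₁ →
    ∃ θstar : ℝ, 0 < θstar ∧ ∀ θ : ℝ, θstar < θ →
    ∃ kr : ℝ, 0 < kr ∧ ∀ ks : Fin N → ℝ, (∀ i, kr < ks i) →
    ∃ cr : ℝ, 0 < cr ∧ ∀ c : Fin N → ℝ, (∀ i, cr < c i) →
    ∃ βr : ℝ, 0 < βr ∧ ∀ β : Fin N → ℝ, (∀ i, βr < β i) →
    ∀ P : Loop N, P = ⟨G.cost, A, g, d, ⟨θ, θbar, ks, c, β⟩⟩ →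
      -- no finite escape: solutions, on whatever interval they live, are uniformly bounded
      (∃ B : ℝ, ∀ (X : ℝ → State N) (τ : ℝ), t₀ ≤ τ → IsSolutionOn P t₀ τ X →
        P.errNorm xs t₀ (X t₀) ≤ v₁ → ∀ t ∈ Set.Icc t₀ τ, P.errNorm xs t (X t) ≤ B) ∧
      -- convergence of the errors, and of the positions to the Nash equilibrium
      (∀ X : ℝ → State N, (∀ τ, t₀ ≤ τ → IsSolutionOn P t₀ τ X) →
        P.errNorm xs t₀ (X t₀) ≤ v₁ →
        Tendsto (fun t => P.errNorm xs t (X t)) atTop (𝓝 0) ∧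
        ∀ i, Tendsto (fun t => (X t).x i) atTop (𝓝 (xs i))) :=
  ⟨G.existsUnique_isNash, fun _ hxs v₁ _ =>
    let ⟨_, _, hs⟩ := G.exists_isDiagonallyStableAt hxs
    corollary3_general N hN hs A g (fun i => (hg i).of_le one_le_two) t₀ d hd θbar hθbar v₁⟩
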